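/- A full binary tree is a rooted plane tree in which every node has either no child (a leaf) or an ordered pair of children, left and right (an internal node). Traverse a full binary tree in post-order. Whenever the fringe subtree that is reached has already been seen during the traversal, replace the edge leading to it by a pointer to the existing copy (so only the first leaf is kept). The resulting plane directed acyclic graph is a \emph{compacted binary tree}; its \emph{size} is its number of internal nodes. Its \emph{spine} is the binary tree obtained by deleting all pointers and the leaf, and its \emph{right height} is the maximal number of right edges on a path in the spine from the root to a node ($0$ if the spine is empty). Let $c_{k,n}$ be the number of compacted binary trees of size $n$ and right height at most $k$. For every integer $k\ge 0$ there is a real constant $\kappa_k>0$, independent of $n$, such that, as $n\to\infty$, $$c_{k,n}\sim \kappa_k\, n!\,\Bigl(4\cos^2\bigl(\tfrac{\pi}{k+3}\bigr)\Bigr)^{n}\, n^{\alpha_k},\qquad \alpha_k=-\frac{k}{2}-\frac{1}{k+3}-\Bigl(\frac14-\frac1{k+3}\Bigr)\frac{1}{\cos^2\bigl(\frac{\pi}{k+3}\bigr)} .$$ Moreover, the critical exponent $\alpha_k$ is irrational if and only if $k\notin\{0,1,3\}$. -/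

import Mathlib

open Filter Asymptotics
open scoped Nat

namespace CompactedTree

/-- A full binary tree: `nil` is a leaf, and every `node` is an internal node with a left and a
right child. -/
abbrev FullTree : Type := BinaryTree Unit

/-- A plane binary tree with pointers. `leaf` is the leaf that is kept, `node` is an internal node,
and `pointer i` stands for an edge that points to the vertex with unique identifier `i`: the
identifier `0` belongs to the leaf, and the internal nodes are numbered `1, 2, …` in the order in
which the post-order traversal finishes them. -/
inductive PointerTree : Type
  | leaf : PointerTree
  | pointer (i : ℕ) : PointerTree
  | node (left right : PointerTree) : PointerTree

/-- The compaction procedure (post-order traversal). The list `seen` holds the distinct fringe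
subtrees discovered so far, in order of discovery; the position of a subtree in it is its unique
identifier. A subtree that has already been seen is replaced by a pointer to the existing one;
otherwise it is traversed (left child first, then right child) and then receives the next free
identifier. The procedure returns the compacted object and the updated list. -/
def compactAux : FullTree → List FullTree → PointerTree × List FullTree
  | .nil, seen =>
      if .nil ∈ seen then (.pointer (seen.idxOf .nil), seen)
      else (.leaf, seen ++ [.nil])
  | .node u l r, seen =>
      if .node u l r ∈ seen then (.pointer (seen.idxOf (.node u l r)), seen)
      else
        let a := compactAux l seen
        let b := compactAux r a.2
        (.node a.1 b.1, b.2 ++ [.node u l r])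

/-- The compacted form of a full binary tree: the traversal starts with nothing seen. -/
def compact (t : FullTree) : PointerTree := (compactAux t []).1

/-- A compacted binary tree is the result of the compaction of some full binary tree. -/
def IsCompacted (c : PointerTree) : Prop := ∃ t : FullTree, compact t = c

/-- The size: the number of internal nodes. -/
def PointerTree.size : PointerTree → ℕ
  | .leaf => 0
  | .pointer _ => 0
  | .node l r => l.size + r.size + 1

/-- The spine: the binary tree (a node may lack its left or its right child, shown by `nil`) that
remains when the pointers and the leaf are deleted. -/
def PointerTree.spine : PointerTree → BinaryTree Unit
  | .leaf => .nil
  | .pointer _ => .nil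
  | .node l r => .node () l.spine r.spine

/-- The maximal number of right edges on a path from the root of a binary tree to one of its nodes,
where `nil` is the absence of a node. -/
def maxRightEdges : BinaryTree Unit → ℕ
  | .nil => 0
  | .node _ l r => max (maxRightEdges l) (if r = .nil then 0 else maxRightEdges r + 1)

/-- The right height: the maximal number of right edges on a path in the spine from the root. -/
def PointerTree.rightHeight (c : PointerTree) : ℕ := maxRightEdges c.spine

/-- The number of compacted binary trees of size `n` and right height at most `k`. -/
noncomputable def count (k n : ℕ) : ℕ :=
  Set.ncard {c : PointerTree | IsCompacted c ∧ c.size = n ∧ c.rightHeight ≤ k}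

/-- The critical exponent
`-k/2 - 1/(k+3) - (1/4 - 1/(k+3)) / cos²(π/(k+3))`. -/
noncomputable def criticalExponent (k : ℕ) : ℝ :=
  -(k : ℝ) / 2 - 1 / ((k : ℝ) + 3)
    - (1 / 4 - 1 / ((k : ℝ) + 3)) * (1 / Real.cos (Real.pi / ((k : ℝ) + 3)) ^ 2)

end CompactedTree

/-! Freeze the post-order traversal: the completed trees still waiting for a right sibling, together
with the current one, form a stack, and an entry lying over `d` others sits below `d` right edges.
Let S(m,h) count the allowed stacks of `h` trees with `m` internal nodes seen, and F(m,h) those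
whose top is a newly completed internal node. A top that is not new is one of m+1 trees, so S(m,h+1)
= F(m,h+1) + (m+1)S(m,h) (`ncard_stacks_succ`). Undoing the last join gives F(m+1,h+1) = S(m,h+2) -
m S(m,h) for h ≤ k (`ncard_freshStacks_succ_succ`), and F(m,h+1) = 0 for h > k. The desired number
is S(n,1).

After division by m!(m+1)^h, F satisfies a linear recursion on k+1 coordinates whose matrix tends to
the one with entries 1 for j < i+2 and 0 elsewhere. With θ = π/(k+3), its Perron eigenvalue is
4cos²θ and both eigenvectors are explicit in sines. A trial solution λ^m (m+1)^(α-1) (r + s/(m+1))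
is correct to relative error O(m⁻²) exactly when s solves a singular linear system. Orthogonality of
its right-hand side to the left eigenvector determines α (`sum_leftPerron_mul_correctionSource`).
Dividing the true solution by the trial one leaves a nonnegative recursion with row sums 1 + O(m⁻²),
and `exists_pos_tendsto_of_doeblin` yields a positive limit.

For irrationality, a rational α with k ≠ 1 makes cos 2θ rational, and Niven's theorem leaves only k
= 0 and k = 3. -/

/-! ### Convergence of nearly stochastic recursions. -/

/-- A positive recursion whose row sums are `1` up to a summable error and which has a column bounded
below (Doeblin's condition) converges to a positive constant vector. -/
theorem exists_pos_tendsto_of_doeblin {ι : Type*} [Fintype ι] (x : ℕ → ι → ℝ)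
    (P : ℕ → ι → ι → ℝ) (ε : ℕ → ℝ) (δ : ℝ) (j₀ : ι) (hδ : 0 < δ)
    (hx : ∀ m i, x (m + 1) i = ∑ j, P m i j * x m j) (hP : ∀ m i j, 0 ≤ P m i j)
    (hsum : ∀ m i, |∑ j, P m i j - 1| ≤ ε m) (hε : Summable ε) (hε2 : ∀ m, ε m ≤ 1 / 2)
    (hδP : ∀ m i, δ ≤ P m i j₀) (hx0 : ∀ i, 0 < x 0 i) :
    ∃ κ : ℝ, 0 < κ ∧ ∀ i, Tendsto (fun m => x m i) atTop (nhds κ) := by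
  have hε0 : ∀ m, 0 ≤ ε m := fun m => (abs_nonneg _).trans (hsum m j₀)
  obtain ⟨lo₀, hlo₀, hlo₀x⟩ : ∃ a : ℝ, 0 < a ∧ ∀ i, a ≤ x 0 i := by
    obtain ⟨i, -, hi⟩ := Finset.exists_min_image Finset.univ (x 0) ⟨j₀, Finset.mem_univ _⟩
    exact ⟨x 0 i, hx0 i, fun j => hi j (Finset.mem_univ _)⟩
  obtain ⟨hi₀, hhi₀x⟩ : ∃ a : ℝ, ∀ i, x 0 i ≤ a := by
    obtain ⟨i, -, hi⟩ := Finset.exists_max_image Finset.univ (x 0) ⟨j₀, Finset.mem_univ _⟩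
    exact ⟨x 0 i, fun j => hi j (Finset.mem_univ _)⟩
  -- Envelopes of `x m`: weight at least `δ` sits in column `j₀`, so each step pulls both bounds
  -- towards `x m j₀`, and the gap shrinks by the factor `1 - δ` up to an error of order `ε m`.
  let hi : ℕ → ℝ := fun m => Nat.rec hi₀ (fun m a => (1 + ε m) * a - δ * (a - x m j₀)) m
  let lo : ℕ → ℝ := fun m => Nat.rec lo₀ (fun m a => (1 - ε m) * a + δ * (x m j₀ - a)) m
  have hhi : ∀ m, hi (m + 1) = (1 + ε m) * hi m - δ * (hi m - x m j₀) := fun m => rfl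
  have hlo : ∀ m, lo (m + 1) = (1 - ε m) * lo m + δ * (x m j₀ - lo m) := fun m => rfl
  have hinv : ∀ m, 0 < lo m ∧ ∀ i, lo m ≤ x m i ∧ x m i ≤ hi m := by
    intro m
    induction m with
    | zero => exact ⟨hlo₀, fun i => ⟨hlo₀x i, hhi₀x i⟩⟩
    | succ m ih =>
      obtain ⟨hpos, hb⟩ := ih
      refine ⟨?_, fun i => ⟨?_, ?_⟩⟩
      · rw [hlo]
        have h1 := hε2 m
        have h2 := (hb j₀).1
        have h3 : 0 ≤ δ * (x m j₀ - lo m) := mul_nonneg hδ.le (by linarith)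
        have h4 : 0 < (1 - ε m) * lo m := mul_pos (by linarith) hpos
        linarith
      · have h1 : P m i j₀ * (x m j₀ - lo m) ≤ ∑ j, P m i j * (x m j - lo m) :=
          Finset.single_le_sum (f := fun j => P m i j * (x m j - lo m))
            (fun j _ => mul_nonneg (hP m i j) (by linarith [(hb j).1])) (Finset.mem_univ j₀)
        have h2 : ∑ j, P m i j * (x m j - lo m) = x (m + 1) i - (∑ j, P m i j) * lo m := by
          rw [hx, Finset.sum_mul, ← Finset.sum_sub_distrib]
          exact Finset.sum_congr rfl fun j _ => by ring
        have h3 := abs_le.1 (hsum m i)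
        have h4 := mul_le_mul_of_nonneg_right (hδP m i)
          (by linarith [(hb j₀).1] : 0 ≤ x m j₀ - lo m)
        have h5 := mul_le_mul_of_nonneg_right
          (by linarith [h3.1] : 1 - ε m ≤ ∑ j, P m i j) hpos.le
        rw [hlo]; linarith
      · have h1 : P m i j₀ * (hi m - x m j₀) ≤ ∑ j, P m i j * (hi m - x m j) :=
          Finset.single_le_sum (f := fun j => P m i j * (hi m - x m j))
            (fun j _ => mul_nonneg (hP m i j) (by linarith [(hb j).2])) (Finset.mem_univ j₀)
        have h2 : ∑ j, P m i j * (hi m - x m j) = (∑ j, P m i j) * hi m - x (m + 1) i := by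
          rw [hx, Finset.sum_mul, ← Finset.sum_sub_distrib]
          exact Finset.sum_congr rfl fun j _ => by ring
        have h3 := abs_le.1 (hsum m i)
        have h4 := mul_le_mul_of_nonneg_right (hδP m i)
          (by linarith [(hb j₀).2] : 0 ≤ hi m - x m j₀)
        have h5 := mul_le_mul_of_nonneg_right
          (by linarith [h3.2] : ∑ j, P m i j ≤ 1 + ε m)
          (by linarith [(hb j₀).1, (hb j₀).2] : 0 ≤ hi m)
        rw [hhi]; linarith
  have hpart : ∀ m, ∑ j ∈ Finset.range m, ε j ≤ ∑' j, ε j := fun m =>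
    hε.sum_le_tsum _ fun j _ => hε0 j
  set S := ∑' j, ε j with hS
  have hhi_le : ∀ m, hi m ≤ hi₀ * Real.exp (∑ j ∈ Finset.range m, ε j) := by
    intro m
    induction m with
    | zero => simp [hi]
    | succ m ih =>
      have h1 := (hinv m).2 j₀
      have h2 : hi (m + 1) ≤ (1 + ε m) * hi m := by
        rw [hhi]; nlinarith [mul_nonneg hδ.le (sub_nonneg.2 h1.2)]
      rw [Finset.sum_range_succ, Real.exp_add, ← mul_assoc]
      have h3 : 1 + ε m ≤ Real.exp (ε m) := by linarith [Real.add_one_le_exp (ε m)]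
      have h4 : 0 ≤ hi m := by linarith [(hinv m).1]
      calc hi (m + 1) ≤ (1 + ε m) * hi m := h2
        _ ≤ Real.exp (ε m) * hi m := by gcongr
        _ ≤ Real.exp (ε m) * (hi₀ * Real.exp (∑ j ∈ Finset.range m, ε j)) := by gcongr
        _ = _ := by ring
  have hlo_le : ∀ m, lo₀ * Real.exp (-(2 * ∑ j ∈ Finset.range m, ε j)) ≤ lo m := by
    intro m
    induction m with
    | zero => simp [lo]
    | succ m ih =>
      have h1 := (hinv m).2 j₀
      have h2 : (1 - ε m) * lo m ≤ lo (m + 1) := by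
        rw [hlo]; nlinarith [mul_nonneg hδ.le (sub_nonneg.2 h1.1)]
      have h3 : Real.exp (-(2 * ε m)) ≤ 1 - ε m := by
        rw [Real.exp_neg, inv_le_comm₀ (Real.exp_pos _) (by linarith [hε2 m])]
        refine le_trans ?_ (Real.add_one_le_exp (2 * ε m))
        rw [inv_le_iff_one_le_mul₀ (by linarith [hε2 m])]
        nlinarith [hε2 m, hε0 m]
      have h4 := (hinv m).1
      rw [Finset.sum_range_succ, mul_add, neg_add, Real.exp_add, ← mul_assoc]
      calc lo₀ * Real.exp (-(2 * ∑ j ∈ Finset.range m, ε j)) * Real.exp (-(2 * ε m))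
          ≤ lo m * (1 - ε m) := by gcongr
        _ ≤ lo (m + 1) := by linarith
  have hhi₀ : 0 ≤ hi₀ := by linarith [hlo₀x j₀, hhi₀x j₀]
  set K := hi₀ * Real.exp S with hK
  have hK0 : 0 ≤ K := by positivity
  have hhiK : ∀ m, hi m ≤ K := fun m => (hhi_le m).trans (by rw [hK]; gcongr; exact hpart m)
  have hosc : ∀ m, 0 ≤ hi m - lo m := fun m => by
    linarith [((hinv m).2 j₀).1, ((hinv m).2 j₀).2]
  have hosc_succ : ∀ m, hi (m + 1) - lo (m + 1) ≤ (1 - δ) * (hi m - lo m) + 2 * K * ε m := by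
    intro m
    rw [hhi, hlo]
    have h1 : ε m * (hi m + lo m) ≤ ε m * (2 * K) := by
      apply mul_le_mul_of_nonneg_left _ (hε0 m)
      linarith [hhiK m, hosc m]
    linarith
  -- Telescoping the contraction bounds `δ` times the sum of the gaps. Summability makes the gap
  -- vanish and, through `hstep`, makes the column `j₀` Cauchy.
  have hosc_sum : Summable fun m => hi m - lo m := by
    refine summable_of_sum_range_le (c := (hi 0 - lo 0 + 2 * K * S) / δ) hosc fun m => ?_
    rw [le_div_iff₀ hδ]
    have key : δ * ∑ j ∈ Finset.range m, (hi j - lo j) + (hi m - lo m) ≤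
        hi 0 - lo 0 + 2 * K * ∑ j ∈ Finset.range m, ε j := by
      induction m with
      | zero => simp
      | succ m ih =>
        rw [Finset.sum_range_succ, Finset.sum_range_succ]
        linarith [hosc_succ m]
    have h2 : 2 * K * ∑ j ∈ Finset.range m, ε j ≤ 2 * K * S := by gcongr; exact hpart m
    linarith [hosc m]
  have hstep : ∀ m, dist (x m j₀) (x (m + 1) j₀) ≤ (hi m - lo m) + K * ε m := by
    intro m
    have h1 := (hinv m).2 j₀
    have h2 := (hinv (m + 1)).2 j₀
    have h3 : hi (m + 1) ≤ hi m + ε m * K := by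
      rw [hhi]
      nlinarith [mul_nonneg hδ.le (sub_nonneg.2 h1.2), mul_le_mul_of_nonneg_left (hhiK m) (hε0 m)]
    have h4 : lo m - ε m * K ≤ lo (m + 1) := by
      rw [hlo]
      nlinarith [mul_nonneg hδ.le (sub_nonneg.2 h1.1),
        mul_le_mul_of_nonneg_left ((by linarith [hhiK m, hosc m] : lo m ≤ K)) (hε0 m)]
    rw [Real.dist_eq, abs_le]
    constructor <;> linarith
  have hcauchy : CauchySeq fun m => x m j₀ :=
    cauchySeq_of_dist_le_of_summable _ hstep (hosc_sum.add (hε.mul_left K))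
  obtain ⟨κ, hκ⟩ := cauchySeq_tendsto_of_complete hcauchy
  refine ⟨κ, ?_, fun i => ?_⟩
  · refine lt_of_lt_of_le (mul_pos hlo₀ (Real.exp_pos (-(2 * S)))) (ge_of_tendsto' hκ fun m => ?_)
    refine le_trans ?_ ((hlo_le m).trans ((hinv m).2 j₀).1)
    gcongr
    exact hpart m
  · have h0 : Tendsto (fun m => x m i - x m j₀) atTop (nhds 0) := by
      refine squeeze_zero_norm (fun m => ?_) hosc_sum.tendsto_atTop_zero
      have h1 := (hinv m).2 j₀
      have h2 := (hinv m).2 i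
      rw [Real.norm_eq_abs, abs_le]
      constructor <;> linarith
    simpa using h0.add hκ

/-! ### Compaction and the list of seen trees. -/

namespace CompactedTree

theorem compactAux_of_mem {t : FullTree} {s : List FullTree} (h : t ∈ s) :
    compactAux t s = (.pointer (s.idxOf t), s) := by
  cases t <;> simp [compactAux, h]

theorem compactAux_node_of_notMem {l r : FullTree} {s : List FullTree}
    (h : BinaryTree.node () l r ∉ s) :
    compactAux (.node () l r) s =
      (.node (compactAux l s).1 (compactAux r (compactAux l s).2).1,
        (compactAux r (compactAux l s).2).2 ++ [.node () l r]) := by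
  simp [compactAux, h]

theorem compactAux_nil_of_notMem {s : List FullTree} (h : (BinaryTree.nil : FullTree) ∉ s) :
    compactAux .nil s = (.leaf, s ++ [.nil]) := by
  simp [compactAux, h]

/-- For a fixed list of seen trees, the compacted object determines the tree. -/
theorem compactAux_fst_injective (s : List FullTree) :
    Function.Injective fun t => (compactAux t s).1 := by
  intro t
  induction t generalizing s with
  | nil =>
    intro t' h
    simp only at h
    by_cases hs : (BinaryTree.nil : FullTree) ∈ s
    · rw [compactAux_of_mem hs] at h
      by_cases ht' : t' ∈ s
      · rw [compactAux_of_mem ht'] at h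
        exact (List.idxOf_inj hs).1 (PointerTree.pointer.inj h)
      · cases t' with
        | nil => rfl
        | node u l r => rw [compactAux_node_of_notMem ht'] at h; cases h
    · rw [compactAux_nil_of_notMem hs] at h
      by_cases ht' : t' ∈ s
      · rw [compactAux_of_mem ht'] at h; cases h
      · cases t' with
        | nil => rfl
        | node u l r => rw [compactAux_node_of_notMem ht'] at h; cases h
  | node u l r ihl ihr =>
    intro t' h
    simp only at h
    by_cases hs : BinaryTree.node u l r ∈ s
    · rw [compactAux_of_mem hs] at h
      by_cases ht' : t' ∈ s
      · rw [compactAux_of_mem ht'] at h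
        exact (List.idxOf_inj hs).1 (PointerTree.pointer.inj h)
      · cases t' with
        | nil => rw [compactAux_nil_of_notMem ht'] at h; cases h
        | node u l r => rw [compactAux_node_of_notMem ht'] at h; cases h
    · rw [compactAux_node_of_notMem hs] at h
      by_cases ht' : t' ∈ s
      · rw [compactAux_of_mem ht'] at h; cases h
      · cases t' with
        | nil => rw [compactAux_nil_of_notMem ht'] at h; cases h
        | node u' l' r' =>
          rw [compactAux_node_of_notMem ht'] at h
          obtain ⟨h1, h2⟩ := PointerTree.node.inj h
          -- Once the left subtrees agree, both right subtrees are traversed with the same list, so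
          -- the second induction hypothesis applies.
          obtain rfl := ihl s h1
          obtain rfl := ihr _ h2
          rfl

/-- The number of internal nodes among the trees seen so far. -/
def nodesSeen (s : List FullTree) : ℕ := (s.filter (· ≠ .nil)).length

theorem nodesSeen_compactAux (t : FullTree) (s : List FullTree) :
    nodesSeen (compactAux t s).2 = nodesSeen s + (compactAux t s).1.size := by
  induction t generalizing s with
  | nil =>
    by_cases hs : (BinaryTree.nil : FullTree) ∈ s
    · simp [compactAux_of_mem hs, PointerTree.size]
    · simp [compactAux_nil_of_notMem hs, PointerTree.size, nodesSeen]
  | node u l r ihl ihr =>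
    by_cases hs : BinaryTree.node u l r ∈ s
    · simp [compactAux_of_mem hs, PointerTree.size]
    · rw [compactAux_node_of_notMem hs, PointerTree.size]
      have : ∀ s' : List FullTree, nodesSeen (s' ++ [.node () l r]) = nodesSeen s' + 1 := by
        intro s'; simp [nodesSeen]
      simp only [this, ihl, ihr]
      ring

/-- A traversal discovers only subtrees of the tree traversed. Hence a node cannot be discovered
while its own children are traversed, which keeps the list free of duplicates. -/
theorem numNodes_le_of_mem_compactAux {t t' : FullTree} {s : List FullTree}
    (h : t' ∈ (compactAux t s).2) : t' ∈ s ∨ t'.numNodes ≤ t.numNodes := by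
  induction t generalizing s with
  | nil =>
    by_cases hs : (BinaryTree.nil : FullTree) ∈ s
    · rw [compactAux_of_mem hs] at h; exact .inl h
    · rw [compactAux_nil_of_notMem hs] at h
      rcases List.mem_append.1 h with h | h
      · exact .inl h
      · rw [List.mem_singleton.1 h]; exact .inr le_rfl
  | node u l r ihl ihr =>
    by_cases hs : BinaryTree.node u l r ∈ s
    · rw [compactAux_of_mem hs] at h; exact .inl h
    · rw [compactAux_node_of_notMem hs] at h
      rcases List.mem_append.1 h with h | h
      · rcases ihr h with h | h
        · rcases ihl h with h | h
          · exact .inl h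
          · right; simp only [BinaryTree.numNodes]; omega
        · right; simp only [BinaryTree.numNodes]; omega
      · rw [List.mem_singleton.1 h]; exact .inr le_rfl

theorem subset_compactAux (t : FullTree) (s : List FullTree) : s ⊆ (compactAux t s).2 := by
  induction t generalizing s with
  | nil =>
    by_cases hs : (BinaryTree.nil : FullTree) ∈ s
    · simp [compactAux_of_mem hs]
    · simp [compactAux_nil_of_notMem hs]
  | node u l r ihl ihr =>
    by_cases hs : BinaryTree.node u l r ∈ s
    · simp [compactAux_of_mem hs]
    · rw [compactAux_node_of_notMem hs]
      exact fun t ht => List.mem_append_left _ (ihr _ (ihl s ht))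

theorem self_mem_compactAux (t : FullTree) (s : List FullTree) : t ∈ (compactAux t s).2 := by
  by_cases hs : t ∈ s
  · simpa [compactAux_of_mem hs] using hs
  · cases t with
    | nil => simp [compactAux_nil_of_notMem hs]
    | node u l r => rw [compactAux_node_of_notMem hs]; simp

/-- A list of distinct trees that contains the children of each of its members. -/
structure IsPool (s : List FullTree) : Prop where
  nodup : s.Nodup
  left_mem : ∀ {l r : FullTree}, BinaryTree.node () l r ∈ s → l ∈ s
  right_mem : ∀ {l r : FullTree}, BinaryTree.node () l r ∈ s → r ∈ s

theorem IsPool.compactAux {s : List FullTree} (hs : IsPool s) (t : FullTree) :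
    IsPool (compactAux t s).2 := by
  induction t generalizing s with
  | nil =>
    by_cases h : (BinaryTree.nil : FullTree) ∈ s
    · rwa [compactAux_of_mem h]
    · rw [compactAux_nil_of_notMem h]
      refine ⟨?_, ?_, ?_⟩
      · exact List.nodup_append.2 ⟨hs.nodup, by simp, by
          intro a ha b hb; rw [List.mem_singleton.1 hb]; rintro rfl; exact h ha⟩
      · intro l r hlr
        simp only [List.mem_append, List.mem_singleton, reduceCtorEq, or_false] at hlr
        exact List.mem_append_left _ (hs.left_mem hlr)
      · intro l r hlr
        simp only [List.mem_append, List.mem_singleton, reduceCtorEq, or_false] at hlr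
        exact List.mem_append_left _ (hs.right_mem hlr)
  | node u l r ihl ihr =>
    by_cases h : BinaryTree.node u l r ∈ s
    · rwa [compactAux_of_mem h]
    · rw [compactAux_node_of_notMem h]
      have h2 := ihr (ihl hs)
      have hnew : BinaryTree.node () l r ∉
          (CompactedTree.compactAux r (CompactedTree.compactAux l s).2).2 := by
        intro hmem
        rcases numNodes_le_of_mem_compactAux hmem with hmem | hmem
        · rcases numNodes_le_of_mem_compactAux hmem with hmem | hmem
          · exact h hmem
          · simp only [BinaryTree.numNodes] at hmem; omega
        · simp only [BinaryTree.numNodes] at hmem; omega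
      refine ⟨?_, ?_, ?_⟩
      · exact List.nodup_append.2 ⟨h2.nodup, by simp, by
          intro a ha b hb; rw [List.mem_singleton.1 hb]; rintro rfl; exact hnew ha⟩
      · intro l' r' hlr
        refine List.mem_append_left _ ?_
        rcases List.mem_append.1 hlr with hlr | hlr
        · exact h2.left_mem hlr
        · obtain ⟨-, rfl, rfl⟩ := BinaryTree.node.inj (List.mem_singleton.1 hlr)
          exact subset_compactAux _ _ (self_mem_compactAux _ _)
      · intro l' r' hlr
        refine List.mem_append_left _ ?_
        rcases List.mem_append.1 hlr with hlr | hlr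
        · exact h2.right_mem hlr
        · obtain ⟨-, rfl, rfl⟩ := BinaryTree.node.inj (List.mem_singleton.1 hlr)
          exact self_mem_compactAux _ _

theorem IsPool.card_internal {s : List FullTree} (hs : IsPool s) :
    (s.toFinset.erase .nil).card = nodesSeen s := by
  rw [nodesSeen, ← List.toFinset_card_of_nodup (hs.nodup.filter _)]
  congr 1
  ext t
  simp [and_comm]

/-- `.nil` is always available: as a pointer if a leaf has been seen, as the kept leaf otherwise.
Either way it counts once. -/
theorem IsPool.card_pointers {s : List FullTree} (hs : IsPool s) :
    (insert .nil s.toFinset).card = nodesSeen s + 1 := by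
  rw [← hs.card_internal, ← Finset.card_insert_of_notMem (Finset.notMem_erase .nil s.toFinset)]
  congr 1
  ext t
  by_cases ht : t = .nil <;> simp [ht]

/-! ### Counting stacks. -/

/-- The list of trees seen after the trees of a stack (top first) have been traversed. -/
def seenAfter : List FullTree → List FullTree
  | [] => []
  | t :: L => (compactAux t (seenAfter L)).2

theorem isPool_seenAfter (L : List FullTree) : IsPool (seenAfter L) := by
  induction L with
  | nil => exact ⟨List.nodup_nil, by simp [seenAfter], by simp [seenAfter]⟩
  | cons t L ih => exact ih.compactAux t

/-- Each tree of the stack respects the bound `k` on the right height, where a tree lying over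
`d` others sits below `d` right edges. -/
def Allowed (k : ℕ) : List FullTree → Prop
  | [] => True
  | t :: L => Allowed k L ∧ ((compactAux t (seenAfter L)).1.spine = .nil ∨
      maxRightEdges (compactAux t (seenAfter L)).1.spine + L.length ≤ k)

/-- The allowed stacks of `h` trees with `m` internal nodes seen. -/
def stackSet (k m h : ℕ) : Set (List FullTree) :=
  {L | L.length = h ∧ Allowed k L ∧ nodesSeen (seenAfter L) = m}

/-- The top of the stack is an internal node of the compacted object. -/
def FreshTop : List FullTree → Prop
  | [] => False
  | t :: L => t ∉ seenAfter L ∧ t ≠ .nil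

/-- The allowed stacks whose top has just been completed. -/
def freshStacks (k m h : ℕ) : Set (List FullTree) := {L ∈ stackSet k m h | FreshTop L}

theorem count_eq_ncard_stacks (k n : ℕ) : count k n = (stackSet k n 1).ncard := by
  have : {c : PointerTree | IsCompacted c ∧ c.size = n ∧ c.rightHeight ≤ k} =
      (fun L => compact (L.headD .nil)) '' stackSet k n 1 := by
    ext c
    simp only [Set.mem_ofPred_eq, Set.mem_image, stackSet]
    constructor
    · rintro ⟨⟨t, rfl⟩, h1, h2⟩
      refine ⟨[t], ⟨rfl, ⟨trivial, .inr ?_⟩, ?_⟩, rfl⟩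
      · exact h2
      · change nodesSeen (compactAux t []).2 = n
        rw [nodesSeen_compactAux, ← h1]
        simp [nodesSeen, compact]
    · rintro ⟨L, ⟨h1, h2, h3⟩, rfl⟩
      obtain ⟨t, rfl⟩ := List.length_eq_one_iff.1 h1
      refine ⟨⟨t, rfl⟩, ?_, ?_⟩
      · change nodesSeen (compactAux t []).2 = n at h3
        rw [nodesSeen_compactAux] at h3
        simpa [nodesSeen, compact] using h3
      · rcases h2.2 with h | h
        · have : (compact t).spine = .nil := h
          simp [PointerTree.rightHeight, this, maxRightEdges]
        · exact h
  rw [count, this, Set.InjOn.ncard_image]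
  rintro L ⟨hL, -⟩ L' ⟨hL', -⟩ h
  obtain ⟨t, rfl⟩ := List.length_eq_one_iff.1 hL
  obtain ⟨t', rfl⟩ := List.length_eq_one_iff.1 hL'
  simp only [List.headD_cons] at h
  rw [compactAux_fst_injective [] h]

/-- Counting pairs whose second component has a constant number `c` of choices. -/
theorem finite_and_ncard_of_fibers {α β γ : Type*} {S : Set α} (hS : S.Finite) (F : α → Finset β)
    (c : ℕ) (hF : ∀ a ∈ S, (F a).card = c) (g : α → β → γ)
    (hg : ∀ a b a' b', b ∈ F a → b' ∈ F a' → g a b = g a' b' → a = a' ∧ b = b') :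
    {x | ∃ a ∈ S, ∃ b ∈ F a, g a b = x}.Finite ∧
      {x | ∃ a ∈ S, ∃ b ∈ F a, g a b = x}.ncard = c * S.ncard := by
  classical
  have h : {x | ∃ a ∈ S, ∃ b ∈ F a, g a b = x} =
      ((hS.toFinset.sigma F).image fun p => g p.1 p.2 : Finset γ) := by
    ext x
    simp [and_assoc]
  rw [h]
  refine ⟨Finset.finite_toSet _, ?_⟩
  rw [Set.ncard_coe_finset, Finset.card_image_of_injOn, Finset.card_sigma,
    Finset.sum_congr rfl fun a ha => hF a (hS.mem_toFinset.1 ha), Finset.sum_const,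
    Set.ncard_eq_toFinset_card S hS, smul_eq_mul, mul_comm]
  rintro ⟨a, b⟩ h1 ⟨a', b'⟩ h2 h3
  simp only [Finset.coe_sigma, Set.mem_sigma_iff, Finset.mem_coe] at h1 h2
  obtain ⟨rfl, rfl⟩ := hg a b a' b' h1.2 h2.2 h3
  rfl

theorem compactAux_of_pointer {t : FullTree} {s : List FullTree} (h : t ∈ s ∨ t = .nil) :
    (compactAux t s).1.spine = .nil ∧ nodesSeen (compactAux t s).2 = nodesSeen s := by
  rw [nodesSeen_compactAux]
  by_cases ht : t ∈ s
  · simp [compactAux_of_mem ht, PointerTree.spine, PointerTree.size]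
  · obtain rfl := h.resolve_left ht
    simp [compactAux_nil_of_notMem ht, PointerTree.spine, PointerTree.size]

/-- A top that is not fresh is `.nil` or already seen; it adds no spine and no internal node, so it
may be placed on any allowed stack. -/
theorem stacks_succ_eq (k m h : ℕ) : stackSet k m (h + 1) = freshStacks k m (h + 1) ∪
    {L | ∃ L' ∈ stackSet k m h, ∃ t ∈ insert .nil (seenAfter L').toFinset, t :: L' = L} := by
  ext L
  constructor
  · intro hL
    obtain ⟨hlen, hA, hm⟩ := hL
    cases L with
    | nil => simp at hlen
    | cons t L =>
      by_cases ht : t ∈ seenAfter L ∨ t = .nil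
      · right
        refine ⟨L, ⟨by simpa using hlen, hA.1, ?_⟩, t, by simpa [or_comm] using ht, rfl⟩
        rw [← hm]; exact (compactAux_of_pointer ht).2.symm
      · left
        exact ⟨⟨hlen, hA, hm⟩, not_or.1 ht⟩
  · rintro (hL | ⟨L, ⟨hlen, hA, hm⟩, t, ht, rfl⟩)
    · exact hL.1
    · have ht : t ∈ seenAfter L ∨ t = .nil := by simpa [or_comm] using ht
      exact ⟨by simp [hlen], ⟨hA, .inl (compactAux_of_pointer ht).1⟩,
        (compactAux_of_pointer ht).2.trans hm⟩

theorem finite_and_ncard_pointer_stacks {k m h : ℕ} (hfin : (stackSet k m h).Finite) :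
    {L | ∃ L' ∈ stackSet k m h, ∃ t ∈ insert .nil (seenAfter L').toFinset, t :: L' = L}.Finite ∧
    {L | ∃ L' ∈ stackSet k m h, ∃ t ∈ insert .nil (seenAfter L').toFinset, t :: L' = L}.ncard =
      (m + 1) * (stackSet k m h).ncard := by
  refine finite_and_ncard_of_fibers hfin (fun L => insert .nil (seenAfter L).toFinset) (m + 1)
    (fun L hL => ?_) (fun L t => t :: L) ?_
  · rw [(isPool_seenAfter L).card_pointers, hL.2.2]
  · intro a b a' b' _ _ h
    simpa [and_comm] using h

theorem nodesSeen_pos_of_freshTop {L : List FullTree} (h : FreshTop L) :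
    0 < nodesSeen (seenAfter L) := by
  cases L with
  | nil => exact h.elim
  | cons t L =>
    refine List.length_pos_of_mem (a := t) (List.mem_filter.2 ⟨self_mem_compactAux _ _, ?_⟩)
    simpa using h.2

theorem freshStacks_zero_left (k h : ℕ) : freshStacks k 0 h = ∅ := by
  ext L
  simp only [Set.mem_empty_iff_false, iff_false]
  rintro ⟨⟨-, -, h0⟩, hf⟩
  exact (nodesSeen_pos_of_freshTop hf).ne' h0

theorem freshStacks_zero_right (k m : ℕ) : freshStacks k m 0 = ∅ := by
  ext L
  simp only [Set.mem_empty_iff_false, iff_false]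
  rintro ⟨⟨h0, -, -⟩, hf⟩
  rw [List.length_eq_zero_iff.1 h0] at hf
  exact hf

/-- Stacks whose two top trees can be joined to a tree that is not seen yet. -/
def Joinable : List FullTree → Prop
  | r :: l :: L => BinaryTree.node () l r ∉ seenAfter L
  | _ => False

/-- Join the two top trees. -/
def join : List FullTree → List FullTree
  | r :: l :: L => .node () l r :: L
  | L => L

theorem seenAfter_join {l r : FullTree} {L : List FullTree}
    (h : BinaryTree.node () l r ∉ seenAfter L) :
    seenAfter (.node () l r :: L) = seenAfter (r :: l :: L) ++ [.node () l r] := by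
  simp only [seenAfter]
  rw [compactAux_node_of_notMem h]

theorem nodesSeen_join {l r : FullTree} {L : List FullTree}
    (h : BinaryTree.node () l r ∉ seenAfter L) :
    nodesSeen (seenAfter (.node () l r :: L)) = nodesSeen (seenAfter (r :: l :: L)) + 1 := by
  rw [seenAfter_join h]
  simp [nodesSeen]

/-- The two conditions on the right are those that `Allowed` puts on the entries of `r :: l :: L`
when `L` has length `d`. Joining thus preserves the height bound in both directions. -/
theorem maxRightEdges_node (a b : BinaryTree Unit) (d k : ℕ) (hd : d ≤ k) :
    maxRightEdges (.node () a b) + d ≤ k ↔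
      (a = .nil ∨ maxRightEdges a + d ≤ k) ∧ (b = .nil ∨ maxRightEdges b + (d + 1) ≤ k) := by
  have ha : a = .nil → maxRightEdges a = 0 := by rintro rfl; rfl
  by_cases h : a = .nil <;> by_cases h' : b = .nil <;> simp [maxRightEdges, h, h'] <;> omega

theorem freshStacks_succ_succ_eq_image {k h : ℕ} (hh : h ≤ k) (m : ℕ) :
    freshStacks k (m + 1) (h + 1) = join '' {L ∈ stackSet k m (h + 2) | Joinable L} := by
  ext L
  constructor
  · rintro ⟨⟨hlen, hA, hm⟩, hf⟩
    cases L with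
    | nil => exact hf.elim
    | cons t L =>
      cases t with
      | nil => exact (hf.2 rfl).elim
      | node u l r =>
        have hlen' : L.length = h := by simpa using hlen
        have hnot : BinaryTree.node () l r ∉ seenAfter L := hf.1
        obtain ⟨hA1, hA2⟩ := hA
        change (compactAux (.node () l r) (seenAfter L)).1.spine = .nil ∨
          maxRightEdges (compactAux (.node () l r) (seenAfter L)).1.spine + L.length ≤ k at hA2
        rw [compactAux_node_of_notMem hnot] at hA2
        simp only [PointerTree.spine, reduceCtorEq, false_or] at hA2
        rw [maxRightEdges_node _ _ _ _ (hlen' ▸ hh)] at hA2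
        refine ⟨r :: l :: L, ⟨⟨by simp [hlen'], ⟨⟨hA1, hA2.1⟩, hA2.2⟩, ?_⟩, hnot⟩, rfl⟩
        have := nodesSeen_join hnot
        change nodesSeen (seenAfter (.node () l r :: L)) = m + 1 at hm
        omega
  · rintro ⟨L, ⟨⟨hlen, hA, hm⟩, hj⟩, rfl⟩
    match L, hlen, hA, hm, hj with
    | r :: l :: L, hlen, ⟨⟨hA1, hA2⟩, hA3⟩, hm, hj =>
      have hlen' : L.length = h := by simpa using hlen
      have hnot : BinaryTree.node () l r ∉ seenAfter L := hj
      refine ⟨⟨by simp [join, hlen'], ⟨hA1, .inr ?_⟩, ?_⟩, ⟨hnot, by simp⟩⟩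
      · rw [compactAux_node_of_notMem hnot]
        exact (maxRightEdges_node _ _ _ _ (hlen' ▸ hh)).2 ⟨hA2, hA3⟩
      · change nodesSeen (seenAfter (.node () l r :: L)) = m + 1
        rw [nodesSeen_join hnot, hm]

theorem join_injOn (S : Set (List FullTree)) : Set.InjOn join {L ∈ S | Joinable L} := by
  rintro L ⟨-, hL⟩ L' ⟨-, hL'⟩ h
  match L, hL, L', hL' with
  | r :: l :: L, _, r' :: l' :: L', _ =>
    simp only [join, List.cons.injEq, BinaryTree.node.injEq, true_and] at h
    obtain ⟨⟨rfl, rfl⟩, rfl⟩ := h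
    rfl

theorem freshStacks_eq_empty {k h : ℕ} (hh : k < h) (m : ℕ) : freshStacks k m (h + 1) = ∅ := by
  ext L
  simp only [Set.mem_empty_iff_false, iff_false]
  rintro ⟨⟨hlen, hA, -⟩, hf⟩
  cases L with
  | nil => exact hf
  | cons t L =>
    have hlen' : L.length = h := by simpa using hlen
    cases t with
    | nil => exact hf.2 rfl
    | node u l r =>
      have hA2 := hA.2
      have hnot : BinaryTree.node () l r ∉ seenAfter L := hf.1
      change (compactAux (.node () l r) (seenAfter L)).1.spine = .nil ∨
          maxRightEdges (compactAux (.node () l r) (seenAfter L)).1.spine + L.length ≤ k at hA2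
      rw [compactAux_node_of_notMem hnot] at hA2
      simp only [PointerTree.spine, reduceCtorEq, false_or] at hA2
      omega

theorem stacks_zero_right (k m : ℕ) : stackSet k m 0 = if m = 0 then {[]} else ∅ := by
  ext L
  split_ifs with hm
  · subst hm
    simp only [stackSet, Set.mem_ofPred_eq, Set.mem_singleton_iff, List.length_eq_zero_iff]
    constructor
    · exact fun h => h.1
    · rintro rfl
      exact ⟨rfl, trivial, rfl⟩
  · simp only [stackSet, Set.mem_ofPred_eq, Set.mem_empty_iff_false, iff_false, not_and]
    intro h _ h0
    rw [List.length_eq_zero_iff.1 h] at h0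
    exact hm h0.symm

theorem finite_stacks (k m h : ℕ) : (stackSet k m h).Finite := by
  have hzero : ∀ m, (stackSet k m 0).Finite := fun m => by
    rw [stacks_zero_right]; split_ifs <;> simp
  have hstep : ∀ m, (∀ h, (freshStacks k m h).Finite) → ∀ h, (stackSet k m h).Finite := by
    intro m hf h
    induction h with
    | zero => exact hzero m
    | succ h ih =>
      rw [stacks_succ_eq]
      exact (hf _).union (finite_and_ncard_pointer_stacks ih).1
  refine hstep m ?_ h
  induction m with
  | zero => intro h; rw [freshStacks_zero_left]; exact Set.finite_empty
  | succ m ih =>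
    intro h
    cases h with
    | zero => rw [freshStacks_zero_right]; exact Set.finite_empty
    | succ h =>
      rcases le_or_gt h k with hh | hh
      · rw [freshStacks_succ_succ_eq_image hh]
        exact ((hstep m ih _).subset (Set.sep_subset _ _)).image _
      · rw [freshStacks_eq_empty hh]; exact Set.finite_empty

theorem ncard_stacks_succ (k m h : ℕ) : (stackSet k m (h + 1)).ncard =
    (freshStacks k m (h + 1)).ncard + (m + 1) * (stackSet k m h).ncard := by
  have hfin := finite_and_ncard_pointer_stacks (finite_stacks k m h)
  have hfresh : (freshStacks k m (h + 1)).Finite :=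
    (finite_stacks k m (h + 1)).subset (Set.sep_subset _ _)
  rw [← hfin.2, stacks_succ_eq, Set.ncard_union_eq ?_ hfresh hfin.1]
  rw [Set.disjoint_left]
  rintro L ⟨-, hf⟩ ⟨L', -, t, ht, rfl⟩
  simp only [Finset.mem_insert, List.mem_toFinset] at ht
  exact ht.elim hf.2 hf.1

/-- If the joined node is already seen below the pair, so are both children, because the list is
closed under children. The pair then changes nothing and amounts to the choice of one seen internal
node. -/
theorem not_joinable_stacks_eq (k m h : ℕ) : {L ∈ stackSet k m (h + 2) | ¬ Joinable L} =
    {L | ∃ L' ∈ stackSet k m h, ∃ t ∈ (seenAfter L').toFinset.erase .nil,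
      t.right :: t.left :: L' = L} := by
  ext L
  constructor
  · rintro ⟨⟨hlen, hA, hm⟩, hj⟩
    match L, hlen, hA, hm, hj with
    | r :: l :: L, hlen, ⟨⟨hA1, hA2⟩, hA3⟩, hm, hj =>
      have hmem : BinaryTree.node () l r ∈ seenAfter L := not_not.1 hj
      have hl := (isPool_seenAfter L).left_mem hmem
      have hr := (isPool_seenAfter L).right_mem hmem
      refine ⟨L, ⟨by simpa using hlen, hA1, ?_⟩, .node () l r, by simpa using hmem, rfl⟩
      simpa [seenAfter, compactAux_of_mem hl, compactAux_of_mem hr] using hm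
  · rintro ⟨L, ⟨hlen, hA, hm⟩, t, ht, rfl⟩
    simp only [Finset.mem_erase, List.mem_toFinset] at ht
    obtain ⟨ht0, ht⟩ := ht
    cases t with
    | nil => exact (ht0 rfl).elim
    | node u l r =>
      have hl := (isPool_seenAfter L).left_mem ht
      have hr := (isPool_seenAfter L).right_mem ht
      have h1 : seenAfter (l :: L) = seenAfter L := by simp [seenAfter, compactAux_of_mem hl]
      have h2 : seenAfter (r :: l :: L) = seenAfter L := by
        rw [seenAfter, h1, compactAux_of_mem hr]
      refine ⟨⟨by simp [hlen], ⟨⟨hA, .inl ?_⟩, .inl ?_⟩, ?_⟩, not_not.2 ht⟩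
      · exact (compactAux_of_pointer (.inl hl)).1
      · exact (compactAux_of_pointer (.inl (h1 ▸ hr))).1
      · change nodesSeen (seenAfter (r :: l :: L)) = m
        rw [h2, hm]

/-- Splitting off the top node is a bijection onto the joinable stacks; the others number `m` for
each stack of height `h`. -/
theorem ncard_freshStacks_succ_succ {k h : ℕ} (hh : h ≤ k) (m : ℕ) :
    (freshStacks k (m + 1) (h + 1)).ncard + m * (stackSet k m h).ncard =
      (stackSet k m (h + 2)).ncard := by
  have hfin := finite_stacks k m (h + 2)
  have hbad : {L ∈ stackSet k m (h + 2) | ¬ Joinable L}.ncard = m * (stackSet k m h).ncard := by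
    rw [not_joinable_stacks_eq]
    refine (finite_and_ncard_of_fibers (finite_stacks k m h)
      (fun L => (seenAfter L).toFinset.erase .nil) m (fun L hL => ?_)
      (fun L t => t.right :: t.left :: L) ?_).2
    · rw [(isPool_seenAfter L).card_internal, hL.2.2]
    · intro a b a' b' hb hb' h
      simp only [List.cons.injEq] at h
      refine ⟨h.2.2, ?_⟩
      cases b with
      | nil => simp at hb
      | node u l r =>
        cases b' with
        | nil => simp at hb'
        | node u' l' r' =>
          have h1 : r = r' := h.1
          have h2 : l = l' := h.2.1
          rw [h1, h2]
  rw [freshStacks_succ_succ_eq_image hh, (join_injOn _).ncard_image, ← hbad,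
    ← Set.ncard_union_eq ?_ (hfin.subset (Set.sep_subset _ _)) (hfin.subset (Set.sep_subset _ _))]
  · congr 1
    ext L
    by_cases hL : Joinable L <;> simp [hL]
  · rw [Set.disjoint_left]
    exact fun L h1 h2 => h2.2 h1.2

end CompactedTree

/-! ### Two trigonometric sums. -/

theorem sum_sin_mul_sin_succ {n : ℕ} (hn : 2 ≤ n) :
    ∑ h ∈ Finset.range n, Real.sin (h * (Real.pi / n)) * Real.sin ((h + 1) * (Real.pi / n)) =
      n / 2 * Real.cos (Real.pi / n) := by
  have hn0 : (0 : ℝ) < n := by positivity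
  set θ := Real.pi / n with hθ
  have hnθ : n * θ = Real.pi := by rw [hθ]; field_simp
  have hsin : Real.sin θ ≠ 0 := by
    refine (Real.sin_pos_of_pos_of_lt_pi (by positivity) ?_).ne'
    rw [hθ]
    exact div_lt_self Real.pi_pos (by exact_mod_cast (by omega : 1 < n))
  -- After multiplication by `sin θ` every partial sum has a closed form, whose boundary term
  -- vanishes when Nθ = π.
  have key : ∀ N : ℕ, Real.sin θ *
      ∑ h ∈ Finset.range N, Real.sin (h * θ) * Real.sin ((h + 1) * θ) =
      Real.sin θ * (N / 2 * Real.cos θ) - Real.sin (2 * (N * θ)) / 4 := by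
    intro N
    induction N with
    | zero => simp
    | succ N ih =>
      rw [Finset.sum_range_succ, mul_add, ih]
      push_cast
      rw [show 2 * (((N : ℝ) + 1) * θ) = 2 * (N * θ) + 2 * θ by ring, add_mul _ _ θ, one_mul]
      simp only [Real.sin_add, Real.sin_two_mul, Real.cos_two_mul]
      have h1 := Real.sin_sq_add_cos_sq θ
      have h2 := Real.sin_sq_add_cos_sq (N * θ)
      generalize Real.sin (N * θ) = S at *
      generalize Real.cos (N * θ) = C at *
      generalize Real.sin θ = s at *
      generalize Real.cos θ = c at *
      linear_combination (S * C) * h1 + (s * c) * h2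
  have := key n
  rw [hnθ, Real.sin_two_pi] at this
  simpa using mul_left_cancel₀ hsin (this.trans (by ring : _ = Real.sin θ * (n / 2 * Real.cos θ)))

theorem sum_mul_sin_mul_sin_succ {n : ℕ} (hn : 2 ≤ n) :
    ∑ h ∈ Finset.range n,
        (h : ℝ) * (Real.sin (h * (Real.pi / n)) * Real.sin ((h + 1) * (Real.pi / n))) =
      ((n : ℝ) - 1) / 2 * (n / 2 * Real.cos (Real.pi / n)) := by
  rw [← sum_sin_mul_sin_succ hn]
  have hn0 : (0 : ℝ) < n := by positivity
  set θ := Real.pi / n with hθ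
  have hnθ : n * θ = Real.pi := by rw [hθ]; field_simp
  -- The reflection h ↦ n-1-h swaps the two sine factors, so the weight `h` may be replaced by its
  -- average (n-1)/2.
  have hrefl := Finset.sum_range_reflect
    (fun h : ℕ => (h : ℝ) * (Real.sin (h * θ) * Real.sin ((h + 1) * θ))) n
  have : ∑ h ∈ Finset.range n, (((n - 1 - h : ℕ) : ℝ) *
        (Real.sin ((n - 1 - h : ℕ) * θ) * Real.sin (((n - 1 - h : ℕ) + 1) * θ))) =
      ∑ h ∈ Finset.range n,
        ((n : ℝ) - 1 - h) * (Real.sin (h * θ) * Real.sin ((h + 1) * θ)) := by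
    refine Finset.sum_congr rfl fun h hh => ?_
    have hh' := Finset.mem_range.1 hh
    have hc : ((n - 1 - h : ℕ) : ℝ) = n - 1 - h := by
      rw [Nat.cast_sub (by omega), Nat.cast_sub (by omega)]; simp
    rw [hc, show ((n : ℝ) - 1 - h) * θ = Real.pi - (h + 1) * θ by rw [← hnθ]; ring,
      show ((n : ℝ) - 1 - h + 1) * θ = Real.pi - h * θ by rw [← hnθ]; ring,
      Real.sin_pi_sub, Real.sin_pi_sub, mul_comm (Real.sin ((h + 1) * θ))]
  rw [this] at hrefl
  have hsub : ∑ h ∈ Finset.range n,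
        ((n : ℝ) - 1 - h) * (Real.sin (h * θ) * Real.sin ((h + 1) * θ)) =
      ((n : ℝ) - 1) * ∑ h ∈ Finset.range n, Real.sin (h * θ) * Real.sin ((h + 1) * θ) -
      ∑ h ∈ Finset.range n, (h : ℝ) * (Real.sin (h * θ) * Real.sin ((h + 1) * θ)) := by
    rw [Finset.mul_sum, ← Finset.sum_sub_distrib]
    exact Finset.sum_congr rfl fun h _ => by ring
  rw [hsub] at hrefl
  linarith

/-! ### Perron eigenvectors and the critical exponent. -/

namespace CompactedTree

/-- The angle `π / (k + 3)`. -/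
noncomputable def angle (k : ℕ) : ℝ := Real.pi / ((k : ℝ) + 3)

theorem angle_pos (k : ℕ) : 0 < angle k := by unfold angle; positivity

theorem add_three_mul_angle (k : ℕ) : ((k : ℝ) + 3) * angle k = Real.pi := by
  unfold angle; field_simp

theorem cos_angle_pos (k : ℕ) : 0 < Real.cos (angle k) := by
  have h := add_three_mul_angle k
  have h0 := angle_pos k
  have hk : 0 ≤ (k : ℝ) * angle k := by positivity
  exact Real.cos_pos_of_mem_Ioo ⟨by linarith [Real.pi_pos], by linarith⟩

theorem sin_mul_angle_pos {k h : ℕ} (h0 : 0 < h) (hk : h < k + 3) :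
    0 < Real.sin (h * angle k) := by
  have h1 := angle_pos k
  refine Real.sin_pos_of_pos_of_lt_pi (by positivity) ?_
  rw [← add_three_mul_angle k]
  gcongr
  exact_mod_cast hk

/-- The dominant growth rate `4 cos² (π / (k + 3))`. -/
noncomputable def growth (k : ℕ) : ℝ := 4 * Real.cos (angle k) ^ 2

theorem growth_pos (k : ℕ) : 0 < growth k := by
  have := cos_angle_pos k
  unfold growth; positivity

/-- Partial sums of the Perron eigenvector. -/
noncomputable def perronSum (k h : ℕ) : ℝ :=
  (2 * Real.cos (angle k)) ^ (h + 1) * Real.sin (h * angle k)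

theorem perronSum_zero (k : ℕ) : perronSum k 0 = 0 := by simp [perronSum]

theorem sin_succ_mul_add (x y : ℝ) :
    Real.sin ((x + 2) * y) = 2 * Real.cos y * Real.sin ((x + 1) * y) - Real.sin (x * y) := by
  rw [show (x + 2) * y = (x + 1) * y + y by ring, show x * y = (x + 1) * y - y by ring,
    Real.sin_add, Real.sin_sub]
  ring

/-- The eigenvalue equation of the limiting matrix, in terms of partial sums: row `i` sums the first
i+2 coordinates. -/
theorem perronSum_add_two (k h : ℕ) :
    perronSum k (h + 2) = growth k * (perronSum k (h + 1) - perronSum k h) := by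
  unfold perronSum growth
  push_cast
  rw [sin_succ_mul_add]
  ring

theorem perronSum_succ_sub_pos {k h : ℕ} (hh : h ≤ k) :
    0 < perronSum k (h + 1) - perronSum k h := by
  have h1 := perronSum_add_two k h
  have h2 : 0 < perronSum k (h + 2) :=
    mul_pos (pow_pos (by linarith [cos_angle_pos k]) _)
      (sin_mul_angle_pos (by omega) (by omega))
  rw [h1] at h2
  exact pos_of_mul_pos_right h2 (growth_pos k).le

/-- The truncation at coordinate `k` holds because sin((k+3)θ) = 0; this fixes the angle. -/
theorem perronSum_top (k : ℕ) : perronSum k (k + 2) = perronSum k (k + 1) := by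
  have h := perronSum_add_two k (k + 1)
  have h0 : perronSum k (k + 3) = 0 := by
    unfold perronSum
    push_cast
    rw [add_three_mul_angle]; simp
  rw [h0] at h
  have := (mul_eq_zero.1 h.symm).resolve_left (growth_pos k).ne'
  linarith

/-- The left Perron eigenvector. -/
noncomputable def leftPerron (k h : ℕ) : ℝ :=
  Real.sin (h * angle k) / (2 * Real.cos (angle k)) ^ h

/-- The recursion adjoint to that of `perronSum`; it makes the sum in `exists_correction` telescope.
-/
theorem leftPerron_rec (k h : ℕ) :
    leftPerron k h + growth k * leftPerron k (h + 2) = growth k * leftPerron k (h + 1) := by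
  have hc := (cos_angle_pos k).ne'
  unfold leftPerron growth
  push_cast
  rw [sin_succ_mul_add]
  field_simp
  ring

theorem leftPerron_top (k : ℕ) : growth k * leftPerron k (k + 2) = leftPerron k (k + 1) := by
  have h := leftPerron_rec k (k + 1)
  have h0 : leftPerron k (k + 3) = 0 := by
    unfold leftPerron
    push_cast
    rw [add_three_mul_angle]; simp
  rw [h0] at h
  linarith

/-- The inhomogeneity in the equation for the first-order correction of the Perron eigenvector. -/
noncomputable def correctionSource (k h : ℕ) : ℝ :=
  ((h : ℝ) + criticalExponent k) * perronSum k (h + 2) + perronSum k h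

theorem leftPerron_mul_perronSum (k h : ℕ) : leftPerron k (h + 1) * perronSum k h =
    Real.sin (h * angle k) * Real.sin ((h + 1) * angle k) := by
  have hc := (cos_angle_pos k).ne'
  unfold leftPerron perronSum
  push_cast
  field_simp

theorem leftPerron_mul_perronSum' (k h : ℕ) : leftPerron k (h + 1) * perronSum k (h + 2) =
    growth k * (Real.sin ((h + 1 : ℕ) * angle k) * Real.sin (((h + 1 : ℕ) + 1) * angle k)) := by
  have hc := (cos_angle_pos k).ne'
  unfold leftPerron perronSum growth
  push_cast
  rw [show (h : ℝ) + 1 + 1 = h + 2 by ring]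
  field_simp
  ring

/-- Solvability of the correction equation: this is what determines the critical exponent. -/
theorem sum_leftPerron_mul_correctionSource (k : ℕ) :
    ∑ h ∈ Finset.range (k + 1), leftPerron k (h + 1) * correctionSource k h = 0 := by
  set θ := angle k with hθ
  set f : ℕ → ℝ := fun h => Real.sin (h * θ) * Real.sin ((h + 1) * θ) with hf
  have hcast : ((k + 3 : ℕ) : ℝ) = k + 3 := by push_cast; ring
  have hangle : Real.pi / ((k + 3 : ℕ) : ℝ) = θ := by rw [hcast]; rfl
  have h1 : ∑ h ∈ Finset.range (k + 3), f h = ((k : ℝ) + 3) / 2 * Real.cos θ := by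
    have := sum_sin_mul_sin_succ (n := k + 3) (by omega)
    rwa [hangle, hcast] at this
  have h2 : ∑ h ∈ Finset.range (k + 3), (h : ℝ) * f h =
      ((k : ℝ) + 3 - 1) / 2 * (((k : ℝ) + 3) / 2 * Real.cos θ) := by
    have := sum_mul_sin_mul_sin_succ (n := k + 3) (by omega)
    rwa [hangle, hcast] at this
  have hf0 : f 0 = 0 := by simp [hf]
  have hpi := add_three_mul_angle k
  rw [← hθ] at hpi
  have hftop : f (k + 2) = 0 := by
    simp only [hf]; push_cast
    rw [show ((k : ℝ) + 2 + 1) * θ = Real.pi by rw [← hpi]; ring]; simp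
  have hflast : f (k + 1) = 2 * Real.cos θ * (1 - Real.cos θ ^ 2) := by
    simp only [hf]; push_cast
    rw [show ((k : ℝ) + 1 + 1) * θ = Real.pi - θ by rw [← hpi]; ring,
      show ((k : ℝ) + 1) * θ = Real.pi - 2 * θ by rw [← hpi]; ring,
      Real.sin_pi_sub, Real.sin_pi_sub, Real.sin_two_mul]
    linear_combination 2 * Real.cos θ * Real.sin_sq_add_cos_sq θ
  have h3 : ∑ h ∈ Finset.range (k + 1), f (h + 1) = ((k : ℝ) + 3) / 2 * Real.cos θ := by
    rw [Finset.sum_range_succ, Finset.sum_range_succ', hf0, hftop] at h1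
    linarith
  have h4 : ∑ h ∈ Finset.range (k + 1), ((h : ℝ) + 1) * f (h + 1) =
      ((k : ℝ) + 3 - 1) / 2 * (((k : ℝ) + 3) / 2 * Real.cos θ) := by
    rw [Finset.sum_range_succ, Finset.sum_range_succ', hf0, hftop] at h2
    push_cast at h2
    linarith
  have h5 : ∑ h ∈ Finset.range (k + 1), f h =
      ((k : ℝ) + 3) / 2 * Real.cos θ - 2 * Real.cos θ * (1 - Real.cos θ ^ 2) := by
    rw [Finset.sum_range_succ, Finset.sum_range_succ, hftop, hflast] at h1
    linarith
  have h6 : ∀ h, leftPerron k (h + 1) * correctionSource k h =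
      growth k * (((h : ℝ) + 1) * f (h + 1)) +
        growth k * (criticalExponent k - 1) * f (h + 1) + f h := by
    intro h
    have e1 := leftPerron_mul_perronSum k h
    have e2 := leftPerron_mul_perronSum' k h
    unfold correctionSource
    simp only [hf]
    linear_combination e1 + ((h : ℝ) + criticalExponent k) * e2
  simp only [h6, Finset.sum_add_distrib, ← Finset.mul_sum, h3, h4, h5]
  have hc : Real.cos θ ≠ 0 := (cos_angle_pos k).ne'
  have hcrit : criticalExponent k = -(k : ℝ) / 2 - 1 / ((k : ℝ) + 3)
    - (1 / 4 - 1 / ((k : ℝ) + 3)) * (1 / Real.cos θ ^ 2) := rfl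
  have hk : (k : ℝ) + 3 ≠ 0 := by positivity
  rw [hcrit, growth, ← hθ]
  field_simp
  ring

/-- Partial sums of the first-order correction of the Perron eigenvector. -/
theorem exists_correction (k : ℕ) : ∃ σ : ℕ → ℝ, σ 0 = 0 ∧ σ (k + 2) = σ (k + 1) ∧
    ∀ h, σ (h + 2) = growth k * (σ (h + 1) - σ h) + correctionSource k h := by
  -- The value `σ 1` is free, since multiples of `perronSum` may be added; it is set to 0. Only the
  -- condition at the top remains to be checked.
  let p : ℕ → ℝ × ℝ := fun h => Nat.rec (0, 0)
    (fun h q => (q.2, growth k * (q.2 - q.1) + correctionSource k h)) h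
  have hp : ∀ h, p (h + 1) = ((p h).2, growth k * ((p h).2 - (p h).1) + correctionSource k h) :=
    fun h => rfl
  set σ : ℕ → ℝ := fun h => (p h).1 with hσ
  have hrec : ∀ h, σ (h + 2) = growth k * (σ (h + 1) - σ h) + correctionSource k h := by
    intro h
    simp only [hσ, hp]
  have h0 : σ 0 = 0 := rfl
  have h1 : σ 1 = 0 := rfl
  refine ⟨σ, h0, ?_, hrec⟩
  -- A discrete Lagrange identity. At N = k+1 its right side is zero by solvability, and its left
  -- side is a positive multiple of `σ (k + 2) - σ (k + 1)`.
  have hE : ∀ N, leftPerron k N * σ (N + 1) - growth k * leftPerron k (N + 1) * σ N =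
      ∑ h ∈ Finset.range N, leftPerron k (h + 1) * correctionSource k h := by
    intro N
    induction N with
    | zero => simp [h0, h1]
    | succ N ih =>
      rw [Finset.sum_range_succ, ← ih, hrec]
      linear_combination (-σ (N + 1)) * leftPerron_rec k N
  have h2 := hE (k + 1)
  rw [sum_leftPerron_mul_correctionSource, leftPerron_top, ← mul_sub] at h2
  have hpos : 0 < leftPerron k (k + 1) :=
    div_pos (sin_mul_angle_pos (by omega) (by omega)) (pow_pos (by linarith [cos_angle_pos k]) _)
  have := (mul_eq_zero.1 h2).resolve_left hpos.ne'
  change σ (k + 1 + 1) = σ (k + 1)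
  linarith

/-! ### Irrationality of the exponent. -/

theorem irrational_criticalExponent_iff (k : ℕ) :
    Irrational (criticalExponent k) ↔ k ≠ 0 ∧ k ≠ 1 ∧ k ≠ 3 := by
  constructor
  · intro h
    refine ⟨?_, ?_, ?_⟩
    · rintro rfl
      refine h ⟨0, ?_⟩
      simp only [criticalExponent]
      norm_num
    · rintro rfl
      refine h ⟨-3 / 4, ?_⟩
      simp only [criticalExponent]
      norm_num
    · rintro rfl
      refine h ⟨-16 / 9, ?_⟩
      simp only [criticalExponent]
      norm_num
      rw [div_pow, Real.sq_sqrt (by norm_num)]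
      norm_num
  · rintro ⟨h0, h1, h3⟩ ⟨q, hq⟩
    have hk : (k : ℝ) + 3 ≠ 0 := by positivity
    have hk1 : (k : ℝ) - 1 ≠ 0 := by
      rw [sub_ne_zero]; exact_mod_cast h1
    have hc := (cos_angle_pos k).ne'
    have hcrit : criticalExponent k = -(k : ℝ) / 2 - 1 / ((k : ℝ) + 3)
      - (1 / 4 - 1 / ((k : ℝ) + 3)) * (1 / Real.cos (angle k) ^ 2) := rfl
    -- The formula for the exponent is solved for cos²θ, which is possible because the factor 1/4 -
    -- 1/(k+3) vanishes only at k = 1.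
    have hcos : Real.cos (2 * angle k) =
        ((2 * ((1 / 4 - 1 / ((k : ℚ) + 3)) / (-(k : ℚ) / 2 - 1 / ((k : ℚ) + 3) - q)) - 1 : ℚ) : ℝ) := by
      have e : (-(k : ℝ) / 2 - 1 / ((k : ℝ) + 3) - q) =
          (1 / 4 - 1 / ((k : ℝ) + 3)) * (1 / Real.cos (angle k) ^ 2) := by
        rw [hq, hcrit]; ring
      have e2 : (1 / 4 - 1 / ((k : ℝ) + 3)) ≠ 0 := by
        have : (1 / 4 - 1 / ((k : ℝ) + 3)) = ((k : ℝ) - 1) / (4 * (k + 3)) := by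
          field_simp; ring
        rw [this]
        positivity
      push_cast
      rw [e, Real.cos_two_mul, div_mul_eq_div_div, div_self e2]
      field_simp
    have hbound : 2 * angle k ∈ Set.Icc 0 Real.pi := by
      have := add_three_mul_angle k
      have h' := angle_pos k
      have h'' : 0 ≤ (k : ℝ) * angle k := by positivity
      exact ⟨by linarith, by linarith⟩
    have hrat : ∃ r : ℚ, 2 * angle k = r * Real.pi :=
      ⟨2 / (k + 3), by unfold angle; push_cast; ring⟩
    have hcases := niven_angle_eq hrat ⟨_, hcos⟩ hbound
    have hpi := add_three_mul_angle k
    have hne : ∀ a : ℝ, ((k : ℝ) + 3) * a ≠ 2 → 2 * angle k ≠ a * Real.pi := by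
      intro a ha h
      refine ha (mul_right_cancel₀ Real.pi_ne_zero ?_)
      linear_combination 2 * hpi - ((k : ℝ) + 3) * h
    have hk0 : (k : ℝ) ≠ 0 := by exact_mod_cast h0
    have hk3 : (k : ℝ) ≠ 3 := by exact_mod_cast h3
    simp only [Set.mem_insert_iff, Set.mem_singleton_iff] at hcases
    rcases hcases with h | h | h | h | h
    · linarith [angle_pos k]
    · exact hne (1 / 3) (fun h' => hk3 (by linarith)) (by linarith)
    · exact hne (1 / 2) (fun h' => hk1 (by linarith)) (by linarith)
    · exact hne (2 / 3) (fun h' => hk0 (by linarith)) (by linarith)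
    · refine hne 1 (fun h' => ?_) (by linarith)
      have : (0 : ℝ) ≤ k := by positivity
      linarith

end CompactedTree

/-! ### The scaled recursion and its approximate solution. -/

theorem AnalyticAt.isBigO_sq {f : ℝ → ℝ} (hf : AnalyticAt ℝ f 0) (h0 : f 0 = 0)
    (h1 : HasDerivAt f 0 0) : f =O[nhds 0] fun t => t ^ 2 := by
  obtain ⟨p, hp⟩ := hf
  have h := hp.isBigO_sub_partialSum_pow 2
  have hp0 : ∀ v, p 0 v = 0 := fun v => by rw [hp.coeff_zero, h0]
  have hp1 : ∀ y : ℝ, p 1 (fun _ => y) = 0 := by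
    intro y
    have := hp.hasFDerivAt.unique h1.hasFDerivAt
    have := congrArg (fun L : ℝ →L[ℝ] ℝ => L y) this
    simp at this
    simpa using this
  have hpart : ∀ y, p.partialSum 2 y = 0 := by
    intro y
    rw [FormalMultilinearSeries.partialSum, Finset.sum_range_succ, Finset.sum_range_one, hp0, hp1,
      add_zero]
  simpa [hpart] using h

namespace CompactedTree

/-- The number of stacks with a fresh top, in the scale in which the recursion has bounded
coefficients; the index `j` stands for the height `j + 1`. -/
noncomputable def scaledCount (k m j : ℕ) : ℝ :=
  (freshStacks k m (j + 1)).ncard / (m ! * ((m : ℝ) + 1) ^ (j + 1))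

/-- In this scale the pointer recursion telescopes. The case m = 0 is excluded because the empty
stack would contribute. -/
theorem sum_scaledCount (k : ℕ) {m : ℕ} (hm : m ≠ 0) (h : ℕ) :
    ∑ j ∈ Finset.range h, scaledCount k m j =
      (stackSet k m h).ncard / (m ! * ((m : ℝ) + 1) ^ h) := by
  induction h with
  | zero => simp [stacks_zero_right, hm]
  | succ h ih =>
    rw [Finset.sum_range_succ, ih, ncard_stacks_succ, scaledCount]
    have : (m ! : ℝ) ≠ 0 := by positivity
    have : (m : ℝ) + 1 ≠ 0 := by positivity
    push_cast
    field_simp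
    ring

theorem scaledCount_top (k m : ℕ) : scaledCount k m (k + 1) = 0 := by
  simp [scaledCount, freshStacks_eq_empty (Nat.lt_succ_self k)]

theorem scaledCount_succ {k m i : ℕ} (hm : m ≠ 0) (hi : i ≤ k) :
    scaledCount k (m + 1) i = (((m : ℝ) + 1) / (m + 2)) ^ (i + 1) *
      (∑ j ∈ Finset.range (i + 2), scaledCount k m j -
        m / ((m : ℝ) + 1) ^ 2 * ∑ j ∈ Finset.range i, scaledCount k m j) := by
  rw [sum_scaledCount k hm, sum_scaledCount k hm, ← ncard_freshStacks_succ_succ hi, scaledCount,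
    Nat.factorial_succ]
  have : (m ! : ℝ) ≠ 0 := by positivity
  have : (m : ℝ) + 1 ≠ 0 := by positivity
  have : (m : ℝ) + 2 ≠ 0 := by positivity
  push_cast
  rw [show (m : ℝ) + 1 + 1 = m + 2 by ring, div_pow]
  field_simp
  ring

/-- The coefficients of the recursion for `scaledCount`. -/
noncomputable def stepCoeff (m i j : ℕ) : ℝ :=
  (((m : ℝ) + 1) / (m + 2)) ^ (i + 1) *
    ((if j < i + 2 then 1 else 0) - m / ((m : ℝ) + 1) ^ 2 * (if j < i then 1 else 0))

theorem div_succ_sq_lt_one (m : ℕ) : (m : ℝ) / ((m : ℝ) + 1) ^ 2 < 1 := by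
  rw [div_lt_one (by positivity)]
  nlinarith [(Nat.cast_nonneg m : (0 : ℝ) ≤ m)]

theorem stepCoeff_nonneg (m i j : ℕ) : 0 ≤ stepCoeff m i j := by
  have h := div_succ_sq_lt_one m
  refine mul_nonneg (by positivity) ?_
  split_ifs <;> first | omega | (simp; try linarith)

theorem stepCoeff_zero_pos (m i : ℕ) : 0 < stepCoeff m i 0 := by
  have h := div_succ_sq_lt_one m
  refine mul_pos (by positivity) ?_
  split_ifs <;> first | omega | (simp; try linarith)

/-- For i = k the first sum on the right reaches the index k+1, outside `Fin (k + 1)`; `hf` removes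
that term. -/
theorem sum_stepCoeff_mul {k i : ℕ} (hi : i ≤ k) (m : ℕ) (f : ℕ → ℝ) (hf : f (k + 1) = 0) :
    ∑ j : Fin (k + 1), stepCoeff m i j * f j = (((m : ℝ) + 1) / (m + 2)) ^ (i + 1) *
      (∑ j ∈ Finset.range (i + 2), f j - m / ((m : ℝ) + 1) ^ 2 * ∑ j ∈ Finset.range i, f j) := by
  have hsub : ∀ a ≤ k + 2, ∑ j ∈ Finset.range (k + 2), (if j < a then f j else 0) =
      ∑ j ∈ Finset.range a, f j := by
    intro a ha
    rw [← Finset.sum_filter]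
    congr 1
    ext j
    simp only [Finset.mem_filter, Finset.mem_range]
    omega
  rw [Fin.sum_univ_eq_sum_range (fun j => stepCoeff m i j * f j) (k + 1),
    ← hsub (i + 2) (by omega), ← hsub i (by omega), Finset.mul_sum, ← Finset.sum_sub_distrib,
    Finset.mul_sum, Finset.sum_range_succ _ (k + 1), hf]
  simp only [ite_self, mul_zero, sub_zero, add_zero]
  refine Finset.sum_congr rfl fun j _ => ?_
  unfold stepCoeff
  split_ifs <;> ring

theorem scaledCount_pos {k m i : ℕ} (hm : 2 ≤ m) (hi : i ≤ k) : 0 < scaledCount k m i := by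
  have hnn : ∀ m j, 0 ≤ scaledCount k m j := fun m j => by unfold scaledCount; positivity
  have hstep : ∀ m i, m ≠ 0 → i ≤ k → 0 < scaledCount k m 0 → 0 < scaledCount k (m + 1) i := by
    intro m i hm hi h
    rw [scaledCount_succ hm hi, ← sum_stepCoeff_mul hi m _ (scaledCount_top k m)]
    refine Finset.sum_pos' (fun j _ => mul_nonneg (stepCoeff_nonneg _ _ _) (hnn _ _))
      ⟨0, Finset.mem_univ _, mul_pos (stepCoeff_zero_pos m i) h⟩
  have hfirst : ∀ m, 0 < scaledCount k (m + 1) 0 := by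
    intro m
    induction m with
    | zero =>
      -- The scaled recursion is unavailable at m = 0, so the first value comes from the counts
      -- themselves.
      have h1 := ncard_freshStacks_succ_succ (Nat.zero_le k) 0
      have h2 := ncard_stacks_succ k 0 1
      have h3 := ncard_stacks_succ k 0 0
      simp [stacks_zero_right, freshStacks_zero_left, -Set.ncard_eq_one] at h1 h2 h3
      have : (freshStacks k 1 1).ncard = 1 := by omega
      simp [scaledCount, this]
    | succ m ih => exact hstep (m + 1) 0 (by omega) (Nat.zero_le k) ih
  obtain ⟨m, rfl⟩ := Nat.exists_eq_add_of_le' hm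
  exact hstep (m + 1) i (by omega) hi (hfirst m)

/-- The Perron eigenvector with its first-order correction, given the partial sums `σ` of the
latter. -/
noncomputable def corrected (k : ℕ) (σ : ℕ → ℝ) (i : ℕ) (t : ℝ) : ℝ :=
  (perronSum k (i + 1) + t * σ (i + 1)) - (perronSum k i + t * σ i)

theorem sum_corrected (k : ℕ) {σ : ℕ → ℝ} (h0 : σ 0 = 0) (h : ℕ) (t : ℝ) :
    ∑ j ∈ Finset.range h, corrected k σ j t = perronSum k h + t * σ h := by
  unfold corrected
  rw [Finset.sum_range_sub (fun j => perronSum k j + t * σ j), h0, perronSum_zero]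
  ring

theorem corrected_top (k : ℕ) {σ : ℕ → ℝ} (hσ : σ (k + 2) = σ (k + 1)) (t : ℝ) :
    corrected k σ (k + 1) t = 0 := by
  unfold corrected
  rw [show k + 1 + 1 = k + 2 from rfl, hσ, perronSum_top]
  ring

/-- The approximate solution of the recursion. -/
noncomputable def approxSol (k : ℕ) (σ : ℕ → ℝ) (m i : ℕ) : ℝ :=
  growth k ^ m * ((m : ℝ) + 1) ^ (criticalExponent k - 1) * corrected k σ i (1 / ((m : ℝ) + 1))

/-- Residual of the corrected eigenvector in the recursion, as a function of `t = 1 / (m + 1)`. -/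
theorem isBigO_residual (k : ℕ) {σ : ℕ → ℝ}
    (hσ : ∀ h, σ (h + 2) = growth k * (σ (h + 1) - σ h) + correctionSource k h) (i : ℕ) :
    (fun t : ℝ => (1 + t) ^ (-((i : ℝ) + criticalExponent k)) *
        ((perronSum k (i + 2) + t * σ (i + 2)) - (t - t ^ 2) * (perronSum k i + t * σ i)) -
      growth k * corrected k σ i (t / (1 + t))) =O[nhds 0] fun t => t ^ 2 := by
  apply AnalyticAt.isBigO_sq
  · refine AnalyticAt.sub (AnalyticAt.mul ?_ (by fun_prop)) ?_
    · have h1 : ContDiffAt ℝ ⊤ (fun t : ℝ => 1 + t) 0 := by fun_prop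
      exact (h1.rpow_const_of_ne (by simp)).analyticAt
    · have : AnalyticAt ℝ (fun t : ℝ => t / (1 + t)) 0 :=
        analyticAt_id.div (by fun_prop) (by simp)
      unfold corrected
      fun_prop
  · rw [perronSum_add_two]
    simp [corrected]
  · have hb : HasDerivAt (fun t : ℝ => 1 + t) 1 0 := (hasDerivAt_id 0).const_add 1
    have h1 : HasDerivAt (fun t : ℝ => (1 + t) ^ (-((i : ℝ) + criticalExponent k)))
        (-((i : ℝ) + criticalExponent k)) 0 := by
      have := hb.rpow_const (p := -((i : ℝ) + criticalExponent k)) (.inl (by simp))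
      simpa using this
    have hlin : ∀ h, HasDerivAt (fun t : ℝ => perronSum k h + t * σ h) (σ h) 0 := fun h => by
      simpa using ((hasDerivAt_id (0 : ℝ)).mul_const (σ h)).const_add (perronSum k h)
    have hq : HasDerivAt (fun t : ℝ => t - t ^ 2) 1 0 := by
      simpa using (hasDerivAt_id' (0 : ℝ)).fun_sub (hasDerivAt_pow 2 (0 : ℝ))
    have hN := h1.mul ((hlin (i + 2)).sub (hq.mul (hlin i)))
    have hd : HasDerivAt (fun t : ℝ => t / (1 + t)) 1 0 := by
      simpa using (hasDerivAt_id' (0 : ℝ)).fun_div hb (by simp)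
    have hD : HasDerivAt (fun t : ℝ => growth k * corrected k σ i (t / (1 + t)))
        (growth k * (σ (i + 1) - σ i)) 0 := by
      unfold corrected
      have e := (((hd.mul_const (σ (i + 1))).const_add (perronSum k (i + 1))).sub
        ((hd.mul_const (σ i)).const_add (perronSum k i))).const_mul (growth k)
      simpa using e
    -- The derivative at 0 vanishes precisely by the equation defining the correction `σ`.
    refine (hN.sub hD).congr_deriv ?_
    have e1 := hσ i
    unfold correctionSource at e1
    simp
    linear_combination e1

theorem sum_stepCoeff_mul_approxSol {k i : ℕ} (hi : i ≤ k) {σ : ℕ → ℝ} (h0 : σ 0 = 0)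
    (htop : σ (k + 2) = σ (k + 1)) (m : ℕ) :
    ∑ j : Fin (k + 1), stepCoeff m i j * approxSol k σ m j =
      growth k ^ m * ((m : ℝ) + 2) ^ (criticalExponent k - 1) *
      ((1 + 1 / ((m : ℝ) + 1)) ^ (-((i : ℝ) + criticalExponent k)) *
        ((perronSum k (i + 2) + 1 / ((m : ℝ) + 1) * σ (i + 2)) -
          (1 / ((m : ℝ) + 1) - (1 / ((m : ℝ) + 1)) ^ 2) *
            (perronSum k i + 1 / ((m : ℝ) + 1) * σ i))) := by
  have hm1 : (0 : ℝ) < m + 1 := by positivity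
  have hm2 : (0 : ℝ) < m + 2 := by positivity
  have e1 : ∑ j : Fin (k + 1), stepCoeff m i j * approxSol k σ m j =
      growth k ^ m * ((m : ℝ) + 1) ^ (criticalExponent k - 1) *
        ∑ j : Fin (k + 1), stepCoeff m i j * corrected k σ j (1 / ((m : ℝ) + 1)) := by
    rw [Finset.mul_sum]
    exact Finset.sum_congr rfl fun j _ => by unfold approxSol; ring
  rw [e1, sum_stepCoeff_mul hi m (fun j => corrected k σ j (1 / ((m : ℝ) + 1)))
    (corrected_top k htop _), sum_corrected k h0, sum_corrected k h0]
  have e2 : (m : ℝ) / ((m : ℝ) + 1) ^ 2 = 1 / ((m : ℝ) + 1) - (1 / ((m : ℝ) + 1)) ^ 2 := by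
    field_simp
    ring
  have e3 : (1 + 1 / ((m : ℝ) + 1)) = ((m : ℝ) + 2) / (m + 1) := by field_simp; ring
  -- The exponents i+1, from the scaling, and α-1, from the trial solution, combine to i+α.
  have e4 : ((m : ℝ) + 1) ^ (criticalExponent k - 1) * (((m : ℝ) + 1) / (m + 2)) ^ (i + 1) =
      ((m : ℝ) + 2) ^ (criticalExponent k - 1) *
        (((m : ℝ) + 2) / (m + 1)) ^ (-((i : ℝ) + criticalExponent k)) := by
    rw [Real.div_rpow hm2.le hm1.le, ← Real.rpow_natCast, Real.div_rpow hm1.le hm2.le,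
      mul_div_assoc', mul_div_assoc', div_eq_div_iff (by positivity) (by positivity),
      ← Real.rpow_add hm1, ← Real.rpow_add hm1, ← Real.rpow_add hm2, ← Real.rpow_add hm2]
    push_cast
    ring_nf
    simp
  rw [e2, e3]
  linear_combination (growth k ^ m * ((perronSum k (i + 2) + 1 / ((m : ℝ) + 1) * σ (i + 2)) -
          (1 / ((m : ℝ) + 1) - (1 / ((m : ℝ) + 1)) ^ 2) *
            (perronSum k i + 1 / ((m : ℝ) + 1) * σ i))) * e4

theorem tendsto_corrected {k : ℕ} (σ : ℕ → ℝ) (i : ℕ) {u : ℕ → ℝ}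
    (hu : Tendsto u atTop (nhds 0)) : Tendsto (fun m => corrected k σ i (u m)) atTop
      (nhds (perronSum k (i + 1) - perronSum k i)) := by
  have hc : Continuous fun t => corrected k σ i t := by unfold corrected; fun_prop
  have := (hc.tendsto 0).comp hu
  simpa [corrected, Function.comp_def] using this

theorem tendsto_one_div_succ : Tendsto (fun m : ℕ => 1 / ((m : ℝ) + 1)) atTop (nhds 0) :=
  tendsto_one_div_add_atTop_nhds_zero_nat

theorem isBigO_sum_stepCoeff_div {k i : ℕ} (hi : i ≤ k) {σ : ℕ → ℝ} (h0 : σ 0 = 0)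
    (htop : σ (k + 2) = σ (k + 1))
    (hσ : ∀ h, σ (h + 2) = growth k * (σ (h + 1) - σ h) + correctionSource k h) :
    (fun m : ℕ => (∑ j : Fin (k + 1), stepCoeff m i j * approxSol k σ m j) /
      approxSol k σ (m + 1) i - 1) =O[atTop] fun m : ℕ => (1 / ((m : ℝ) + 1)) ^ 2 := by
  have hres := (isBigO_residual k hσ i).comp_tendsto tendsto_one_div_succ
  have hlim : Tendsto (fun m : ℕ => growth k * corrected k σ i (1 / (((m + 1 : ℕ) : ℝ) + 1)))
      atTop (nhds (growth k * (perronSum k (i + 1) - perronSum k i))) :=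
    (tendsto_corrected σ i ((tendsto_add_atTop_iff_nat 1).2 tendsto_one_div_succ)).const_mul _
  have hpos : 0 < growth k * (perronSum k (i + 1) - perronSum k i) :=
    mul_pos (growth_pos k) (perronSum_succ_sub_pos hi)
  have hinv : (fun m : ℕ => (growth k * corrected k σ i (1 / (((m + 1 : ℕ) : ℝ) + 1)))⁻¹)
      =O[atTop] fun _ => (1 : ℝ) := (hlim.inv₀ hpos.ne').isBigO_one ℝ
  refine (IsBigO.congr' (hres.mul hinv) ?_ (by simp))
  filter_upwards [hlim.eventually_ne hpos.ne'] with m hm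
  rw [sum_stepCoeff_mul_approxSol hi h0 htop, approxSol]
  simp only [Function.comp_apply]
  have e : (1 / ((m : ℝ) + 1)) / (1 + 1 / ((m : ℝ) + 1)) = 1 / (((m + 1 : ℕ) : ℝ) + 1) := by
    push_cast
    field_simp
  have e' : (((m + 1 : ℕ) : ℝ) + 1) = (m : ℝ) + 2 := by push_cast; ring
  rw [e]
  have hg := (growth_pos k).ne'
  have hp : ((m : ℝ) + 2) ^ (criticalExponent k - 1) ≠ 0 :=
    (Real.rpow_pos_of_pos (by positivity) _).ne'
  rw [e'] at hm ⊢
  have hc : corrected k σ i (1 / ((m : ℝ) + 2)) ≠ 0 := right_ne_zero_of_mul hm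
  generalize corrected k σ i (1 / ((m : ℝ) + 2)) = C at *
  generalize ((m : ℝ) + 2) ^ (criticalExponent k - 1) = Q at *
  rw [pow_succ]
  field_simp
  ring

theorem tendsto_stepCoeff_zero (i : ℕ) : Tendsto (fun m : ℕ => stepCoeff m i 0) atTop (nhds 1) := by
  have h := tendsto_one_div_succ
  have h1 : Tendsto (fun m : ℕ => (1 + 1 / ((m : ℝ) + 1))⁻¹ ^ (i + 1)) atTop (nhds 1) := by
    have := ((h.const_add 1).inv₀ (by norm_num)).pow (i + 1)
    simpa using this
  have h2 : Tendsto (fun m : ℕ => (1 : ℝ) - (1 / ((m : ℝ) + 1) - (1 / ((m : ℝ) + 1)) ^ 2) *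
      (if 0 < i then 1 else 0)) atTop (nhds 1) := by
    have := ((h.sub (h.pow 2)).mul_const (if 0 < i then (1 : ℝ) else 0)).const_sub 1
    simpa using this
  have h3 := h1.mul h2
  rw [mul_one] at h3
  refine h3.congr fun m => ?_
  unfold stepCoeff
  rw [if_pos (by omega : 0 < i + 2)]
  have e1 : (1 + 1 / ((m : ℝ) + 1))⁻¹ = ((m : ℝ) + 1) / (m + 2) := by
    have : (m : ℝ) + 1 ≠ 0 := by positivity
    have : (m : ℝ) + 2 ≠ 0 := by positivity
    rw [show 1 + 1 / ((m : ℝ) + 1) = ((m : ℝ) + 2) / (m + 1) by field_simp; ring, inv_div]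
  have e2 : 1 / ((m : ℝ) + 1) - (1 / ((m : ℝ) + 1)) ^ 2 = (m : ℝ) / ((m : ℝ) + 1) ^ 2 := by
    field_simp
    ring
  rw [e1, e2]

/-! ### Convergence and the final asymptotics. -/

theorem exists_tendsto_scaledCount_div_approxSol (k : ℕ) {σ : ℕ → ℝ} (h0 : σ 0 = 0)
    (htop : σ (k + 2) = σ (k + 1))
    (hσ : ∀ h, σ (h + 2) = growth k * (σ (h + 1) - σ h) + correctionSource k h) :
    ∃ κ : ℝ, 0 < κ ∧
      Tendsto (fun m => scaledCount k m 0 / approxSol k σ m 0) atTop (nhds κ) := by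
  have hr : ∀ i : Fin (k + 1), 0 < perronSum k (i + 1) - perronSum k i := fun i =>
    perronSum_succ_sub_pos (by omega)
  have hgrow := growth_pos k
  have hcorr : ∀ i : Fin (k + 1), ∀ᶠ m : ℕ in atTop, 0 < corrected k σ i (1 / ((m : ℝ) + 1)) :=
    fun i => (tendsto_corrected σ i tendsto_one_div_succ).eventually (lt_mem_nhds (hr i))
  have hbound : ∀ i : Fin (k + 1), ∃ C : ℝ, ∀ᶠ m : ℕ in atTop,
      |(∑ j : Fin (k + 1), stepCoeff m i j * approxSol k σ m j) / approxSol k σ (m + 1) i - 1| ≤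
        C * (1 / ((m : ℝ) + 1)) ^ 2 := by
    intro i
    obtain ⟨C, hC⟩ := (isBigO_sum_stepCoeff_div (by omega : (i : ℕ) ≤ k) h0 htop hσ).bound
    refine ⟨C, hC.mono fun m hm => ?_⟩
    simpa only [Real.norm_eq_abs, abs_of_nonneg (sq_nonneg (1 / ((m : ℝ) + 1)))] using hm
  choose C hC using hbound
  set K : ℝ := ∑ i, |C i| with hK
  have hCK : ∀ i, C i ≤ K := fun i => (le_abs_self _).trans
    (Finset.single_le_sum (f := fun i => |C i|) (fun j _ => abs_nonneg _) (Finset.mem_univ i))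
  have hlimP : ∀ i : Fin (k + 1), Tendsto
      (fun m : ℕ => stepCoeff m i 0 * approxSol k σ m 0 / approxSol k σ (m + 1) i) atTop
      (nhds ((perronSum k 1 - perronSum k 0) /
        (growth k * (perronSum k (i + 1) - perronSum k i)))) := by
    intro i
    have hp : Tendsto (fun m : ℕ => (1 + 1 / ((m : ℝ) + 1)) ^ (-(criticalExponent k - 1))) atTop
        (nhds 1) := by
      have := (tendsto_one_div_succ.const_add 1).rpow_const (p := -(criticalExponent k - 1))
        (.inl (by norm_num))
      simpa using this
    have h1 := tendsto_corrected (k := k) σ 0 tendsto_one_div_succ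
    have h2 := tendsto_corrected (k := k) σ i
      ((tendsto_add_atTop_iff_nat 1).2 tendsto_one_div_succ)
    have h3 := (((tendsto_stepCoeff_zero i).mul hp).mul h1).div (h2.const_mul (growth k))
      (mul_pos hgrow (hr i)).ne'
    rw [mul_one, one_mul, zero_add] at h3
    refine h3.congr' ?_
    filter_upwards with m
    have hm1 : (0 : ℝ) < m + 1 := by positivity
    have hm2 : (0 : ℝ) < m + 2 := by positivity
    have e3 : (1 + 1 / ((m : ℝ) + 1)) = ((m : ℝ) + 2) / (m + 1) := by field_simp; ring
    have e' : (((m + 1 : ℕ) : ℝ) + 1) = (m : ℝ) + 2 := by push_cast; ring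
    simp only [Pi.div_apply, approxSol, e', e3, Real.rpow_neg (div_pos hm2 hm1).le,
      Real.div_rpow hm2.le hm1.le, inv_div, pow_succ]
    have hq : 0 < ((m : ℝ) + 2) ^ (criticalExponent k - 1) := Real.rpow_pos_of_pos hm2 _
    field_simp
  -- Column 0 of the normalised matrix has positive limits; half of their minimum serves as Doeblin
  -- constant for all large `m`.
  obtain ⟨δ, hδ, hδlt⟩ : ∃ δ : ℝ, 0 < δ ∧ ∀ i : Fin (k + 1), δ <
      (perronSum k 1 - perronSum k 0) / (growth k * (perronSum k (i + 1) - perronSum k i)) := by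
    obtain ⟨i, -, hi⟩ := Finset.exists_min_image Finset.univ (fun i : Fin (k + 1) =>
      (perronSum k 1 - perronSum k 0) / (growth k * (perronSum k (i + 1) - perronSum k i)))
      ⟨0, Finset.mem_univ _⟩
    have hpos : 0 < (perronSum k 1 - perronSum k 0) /
        (growth k * (perronSum k (i + 1) - perronSum k i)) :=
      div_pos (hr 0) (mul_pos hgrow (hr i))
    exact ⟨_, half_pos hpos, fun j => (half_lt_self hpos).trans_le (hi j (Finset.mem_univ _))⟩
  have hsmall : ∀ᶠ m : ℕ in atTop, K * (1 / ((m : ℝ) + 1)) ^ 2 ≤ 1 / 2 := by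
    have := (tendsto_one_div_succ.pow 2).const_mul K
    rw [zero_pow two_ne_zero, mul_zero] at this
    exact (this.eventually (gt_mem_nhds (by norm_num : (0 : ℝ) < 1 / 2))).mono fun _ h => h.le
  obtain ⟨m₀, hm₀⟩ := eventually_atTop.1 ((eventually_all.2 hcorr).and ((eventually_all.2 hC).and
    ((eventually_all.2 fun i => (hlimP i).eventually (lt_mem_nhds (hδlt i))).and
      (hsmall.and (eventually_ge_atTop 2)))))
  have hsol : ∀ m, m₀ ≤ m → ∀ i : Fin (k + 1), 0 < approxSol k σ m i := fun m hm i =>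
    mul_pos (mul_pos (pow_pos hgrow _) (Real.rpow_pos_of_pos (by positivity) _)) ((hm₀ m hm).1 i)
  suffices h : ∃ κ : ℝ, 0 < κ ∧ ∀ i : Fin (k + 1), Tendsto
      (fun m => scaledCount k (m + m₀) i / approxSol k σ (m + m₀) i) atTop (nhds κ) by
    obtain ⟨κ, hκ, hlim⟩ := h
    exact ⟨κ, hκ, (tendsto_add_atTop_iff_nat m₀).1 (hlim 0)⟩
  refine exists_pos_tendsto_of_doeblin
    (fun m (i : Fin (k + 1)) => scaledCount k (m + m₀) i / approxSol k σ (m + m₀) i)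
    (fun m i j => stepCoeff (m + m₀) i j * approxSol k σ (m + m₀) j / approxSol k σ (m + m₀ + 1) i)
    (fun m => K * (1 / (((m + m₀ : ℕ) : ℝ) + 1)) ^ 2) δ 0 hδ ?_ ?_ ?_ ?_ ?_ ?_ ?_
  · intro m i
    have hge : 2 ≤ m + m₀ := (hm₀ (m + m₀) (by omega)).2.2.2.2
    rw [show m + 1 + m₀ = m + m₀ + 1 by ring, scaledCount_succ (by omega) (by omega : (i : ℕ) ≤ k),
      ← sum_stepCoeff_mul (by omega) _ _ (scaledCount_top k _), Finset.sum_div]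
    refine Finset.sum_congr rfl fun j _ => ?_
    have hj := (hsol (m + m₀) (by omega) j).ne'
    field_simp
  · intro m i j
    exact div_nonneg (mul_nonneg (stepCoeff_nonneg _ _ _) (hsol _ (by omega) j).le)
      (hsol _ (by omega) i).le
  · intro m i
    rw [← Finset.sum_div]
    refine ((hm₀ (m + m₀) (by omega)).2.1 i).trans ?_
    exact mul_le_mul_of_nonneg_right (hCK i) (sq_nonneg _)
  · refine Summable.mul_left K ?_
    have hs : Summable fun m : ℕ => (1 / ((m : ℝ) + 1)) ^ 2 := by
      have := (summable_nat_add_iff 1).2 (Real.summable_one_div_nat_pow.2 one_lt_two)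
      refine this.congr fun m => ?_
      push_cast
      rw [div_pow, one_pow]
    exact (summable_nat_add_iff m₀).2 hs
  · exact fun m => (hm₀ (m + m₀) (by omega)).2.2.2.1
  · exact fun m i => ((hm₀ (m + m₀) (by omega)).2.2.1 i).le
  · intro i
    rw [zero_add]
    exact div_pos (scaledCount_pos (hm₀ m₀ le_rfl).2.2.2.2 (by omega)) (hsol m₀ le_rfl i)

/-- The factor n+1 is the reason why `approxSol` carries the exponent α-1. -/
theorem count_eq_scaledCount (k : ℕ) {n : ℕ} (hn : n ≠ 0) :
    (count k n : ℝ) = n ! * ((n : ℝ) + 1) * scaledCount k n 0 := by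
  rw [count_eq_ncard_stacks, ncard_stacks_succ, stacks_zero_right, if_neg hn, scaledCount]
  have : (n : ℝ) + 1 ≠ 0 := by positivity
  simp
  field_simp

theorem exists_count_isEquivalent (k : ℕ) : ∃ κ : ℝ, 0 < κ ∧
    (fun n : ℕ => (count k n : ℝ)) ~[atTop]
      (fun n : ℕ => κ * (n ! : ℝ) * growth k ^ n * (n : ℝ) ^ criticalExponent k) := by
  obtain ⟨σ, h0, htop, hσ⟩ := exists_correction k
  obtain ⟨κ, hκ, hlim⟩ := exists_tendsto_scaledCount_div_approxSol k h0 htop hσ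
  have hr : 0 < perronSum k 1 - perronSum k 0 := perronSum_succ_sub_pos (Nat.zero_le k)
  have hc := tendsto_corrected (k := k) σ 0 tendsto_one_div_succ
  rw [zero_add] at hc
  have hK : 0 < κ * (perronSum k 1 - perronSum k 0) := mul_pos hκ hr
  refine ⟨_, hK, ?_⟩
  have hgrow := growth_pos k
  have hpow : Tendsto (fun n : ℕ => (1 + 1 / (n : ℝ)) ^ criticalExponent k) atTop (nhds 1) := by
    have := (tendsto_one_div_atTop_nhds_zero_nat.const_add (1 : ℝ)).rpow_const
      (p := criticalExponent k) (.inl (by norm_num))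
    simpa using this
  rw [isEquivalent_iff_tendsto_one]
  · have h1 := (((hlim.mul hc).mul hpow).div_const (κ * (perronSum k 1 - perronSum k 0)))
    rw [mul_one, div_self hK.ne'] at h1
    refine h1.congr' ?_
    filter_upwards [eventually_ne_atTop 0, hc.eventually (lt_mem_nhds hr)] with n hn hcn
    have hn0 : (0 : ℝ) < n := by positivity
    have hn1 : (0 : ℝ) < (n : ℝ) + 1 := by positivity
    rw [Pi.div_apply, count_eq_scaledCount k hn, approxSol,
      show 1 + 1 / (n : ℝ) = ((n : ℝ) + 1) / n by field_simp, Real.div_rpow hn1.le hn0.le,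
      Real.rpow_sub_one hn1.ne']
    have q1 : 0 < (n : ℝ) ^ criticalExponent k := Real.rpow_pos_of_pos hn0 _
    have q2 : 0 < ((n : ℝ) + 1) ^ criticalExponent k := Real.rpow_pos_of_pos hn1 _
    have q3 : (0 : ℝ) < n ! := by positivity
    generalize perronSum k 1 - perronSum k 0 = r at *
    field_simp
  · filter_upwards [eventually_ne_atTop 0] with n hn
    have hn0 : (0 : ℝ) < n := by positivity
    have q1 : 0 < (n : ℝ) ^ criticalExponent k := Real.rpow_pos_of_pos hn0 _
    positivity

end CompactedTree

theorem theorem3p2 (k : ℕ) :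
    (∃ κ : ℝ, 0 < κ ∧
      (fun n : ℕ => (CompactedTree.count k n : ℝ)) ~[atTop]
        (fun n : ℕ => κ * (n ! : ℝ) * (4 * Real.cos (Real.pi / ((k : ℝ) + 3)) ^ 2) ^ n
          * (n : ℝ) ^ CompactedTree.criticalExponent k)) ∧
    (Irrational (CompactedTree.criticalExponent k) ↔ k ≠ 0 ∧ k ≠ 1 ∧ k ≠ 3) :=
  ⟨CompactedTree.exists_count_isEquivalent k, CompactedTree.irrational_criticalExponent_iff k⟩
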